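/- Partitions are identified with their Young diagrams; the box in row $i$ and column $j$ has content $j-i$ and lies on the diagonal $D_{j-i}$. Let $x=(x_1,x_2,\dots)$. A semistandard set-valued tableau of shape $\mu$ is a filling $T$ of the boxes of $\mu$ with finite nonempty sets of positive integers such that $\max A\le \min B$ whenever $A$ is to the left of $B$ in the same row and $\max A<\min B$ whenever $A$ is above $B$ in the same column. Write $|T|$ for the total number of integers in the filling, $|\mu|$ for the number of boxes of $\mu$, and $x^T=\prod_i x_i^{\alpha_i(T)}$, where $\alpha_i(T)$ is the number of sets of the filling that contain $i$. The stable Grothendieck polynomial is the formal power series $G_\mu=\sum_{T}(-1)^{|T|-|\mu|}x^T$, summed over all semistandard set-valued tableaux $T$ of shape $\mu$. A domino is a $1\times 2$ or $2\times 1$ rectangle of boxes. A partition $\lambda$ is pavable if it is a disjoint union of dominoes; such a covering is a paving. Every domino has exactly one box of even content $2k$, and is said to lie on $D_{2k}$; it is of type 1 if its other box has content $2k-1$ and of type 2 if its other box has content $2k+1$. A domino $F_2$ is weakly southeast of $F_1$ if some box $(p,q)$ of $F_2$ satisfies $p\ge i$ and $q\ge j$, where $(i,j)$ is the top left box of $F_1$.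 A set-valued domino tableau $T$ of shape $\lambda$ is a paving of $\lambda$ together with a filling of its dominoes by finite nonempty sets of positive integers such that 1. the minima of the sets weakly increase from left to right along rows, and strictly increase from top to bottom down columns (comparing distinct dominoes); 2. if $F_1,F_2$ are dominoes of the same type and $F_2$ is weakly southeast of $F_1$, then $\max(F_1)\le\min(F_2)$ if $F_1$ lies on $D_{2k}$ and $F_2$ on $D_{2(k+1)}$ for some $k$, and $\max(F_1)<\min(F_2)$ if $F_1$ lies on $D_{2(k+1)}$ and $F_2$ on $D_{2k}$ for some $k$. For such $T$, $|T|$ is the total number of integers in the filling and $x^T=\prod_i x_i^{\alpha_i(T)}$ with $\alpha_i(T)$ the number of dominoes whose set contains $i$. The 2-quotient $(\mu,\nu)$ of $\lambda=(\lambda_1,\dots,\lambda_k)$ is obtained as follows. Let $L=(l_1,\dots,l_k)$ with $l_i=\lambda_i+k-i$. Let $M$ be obtained from $L$ by replacing, from right to left, the even components by $0,2,4,\dots$ and the odd components by $1,3,5,\dots$. Subtract the even components of $M$ from the even components of $L$, divide by $2$ and delete zeros to get $\mu$; do the same with the odd components to get $\nu$. **Theorem.** Let $\lambda$ be a pavable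 partition with 2-quotient $(\mu,\nu)$. Then $$G_\mu G_\nu=\sum_{T}(-1)^{|T|-\frac12|\lambda|}\,x^T,$$ where the sum runs over all set-valued domino tableaux $T$ of shape $\lambda$ (each monomial occurs for only finitely many $T$). -/

import Mathlib

open scoped MvPowerSeries.WithPiTopology

/-! Partitions are identified with their Young diagrams (`YoungDiagram`); the box in row `i` and
column `j`, both counted from `0`, is the pair `(i, j)`. Power series have variables `x_i` indexed
by the positive integers `i : ℕ+`. -/

/-- `A ≤ B` for finite nonempty sets of positive integers, i.e. `max A ≤ min B`. -/
def SetLE (A B : Finset ℕ+) : Prop := ∀ a ∈ A, ∀ b ∈ B, a ≤ b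

/-- `A < B` for finite nonempty sets of positive integers, i.e. `max A < min B`. -/
def SetLT (A B : Finset ℕ+) : Prop := ∀ a ∈ A, ∀ b ∈ B, a < b

/-! ### Semistandard set-valued tableaux and stable Grothendieck polynomials -/

/-- A semistandard set-valued tableau of shape `μ`. The box `c` of `μ` is filled with `entry c`;
outside `μ` the value of `entry` is fixed to be `∅`, so that equal tableaux are equal terms. -/
@[ext]
structure SetValuedTableau (μ : YoungDiagram) where
  entry : ℕ × ℕ → Finset ℕ+
  nonempty : ∀ c ∈ μ, (entry c).Nonempty
  empty_outside : ∀ c, c ∉ μ → entry c = ∅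
  row_weak : ∀ i j₁ j₂, j₁ < j₂ → (i, j₂) ∈ μ → SetLE (entry (i, j₁)) (entry (i, j₂))
  col_strict : ∀ i₁ i₂ j, i₁ < i₂ → (i₂, j) ∈ μ → SetLT (entry (i₁, j)) (entry (i₂, j))

namespace SetValuedTableau

variable {μ : YoungDiagram}

/-- `|T|`: the total number of integers in the filling. -/
def size (T : SetValuedTableau μ) : ℕ := ∑ c ∈ μ.cells, (T.entry c).card

/-- The exponent of `x^T`: the exponent of `x_i` is the number of boxes whose set contains `i`. -/
noncomputable def weight (T : SetValuedTableau μ) : ℕ+ →₀ ℕ :=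
  ∑ c ∈ μ.cells, ∑ i ∈ T.entry c, Finsupp.single i 1

/-- `|μ| ≤ |T|`, so the natural-number subtraction `|T| - |μ|` never truncates. -/
theorem card_le_size (T : SetValuedTableau μ) : μ.card ≤ T.size := by
  have h : ∑ _c ∈ μ.cells, 1 ≤ T.size :=
    Finset.sum_le_sum fun c hc => (T.nonempty c ((YoungDiagram.mem_cells _).1 hc)).card_pos
  simpa using h

theorem entry_subset_support (T : SetValuedTableau μ) {c : ℕ × ℕ} (hc : c ∈ μ.cells) :
    T.entry c ⊆ T.weight.support := by
  intro i hi
  rw [Finsupp.mem_support_iff, weight, Finsupp.finsetSum_apply]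
  intro h
  have h1 := (Finset.sum_eq_zero_iff.1 h) c hc
  rw [Finsupp.finsetSum_apply] at h1
  have h2 := (Finset.sum_eq_zero_iff.1 h1) i hi
  simp at h2

/-- Only finitely many set-valued tableaux of a given shape have a given monomial. -/
theorem finite_weight_eq (α : ℕ+ →₀ ℕ) : {T : SetValuedTableau μ | T.weight = α}.Finite := by
  let f : {T : SetValuedTableau μ | T.weight = α} → (μ.cells → α.support.powerset) :=
    fun T c => ⟨T.1.entry c.1, Finset.mem_powerset.2
      ((T.1.entry_subset_support c.2).trans_eq (congrArg Finsupp.support T.2))⟩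
  refine Set.finite_coe_iff.1 (Finite.of_injective f fun T S h => ?_)
  refine Subtype.ext (SetValuedTableau.ext (funext fun c => ?_))
  by_cases hc : c ∈ μ
  · exact congrArg Subtype.val (congrFun h ⟨c, (YoungDiagram.mem_cells _).2 hc⟩)
  · rw [T.1.empty_outside c hc, S.1.empty_outside c hc]

end SetValuedTableau

/-- The terms `(-1)^{|T| - |μ|} x^T` of the stable Grothendieck polynomial form a summable family,
so the infinite sum defining `stableGrothendieck` is genuine. -/
theorem summable_stableGrothendieck (μ : YoungDiagram) :
    Summable fun T : SetValuedTableau μ =>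
      MvPowerSeries.monomial T.weight ((-1 : ℤ) ^ (T.size - μ.card)) := by
  rw [MvPowerSeries.WithPiTopology.summable_iff_summable_coeff]
  intro α
  refine summable_of_hasFiniteSupport ((SetValuedTableau.finite_weight_eq α).subset ?_)
  intro T hT
  by_contra h
  exact hT (MvPowerSeries.coeff_monomial_ne (fun h' => h h'.symm) _)

/-- The stable Grothendieck polynomial `G_μ = ∑_T (-1)^{|T| - |μ|} x^T`, the sum over all
semistandard set-valued tableaux `T` of shape `μ`. The sum is the coefficientwise one. -/
noncomputable def stableGrothendieck (μ : YoungDiagram) : MvPowerSeries ℕ+ ℤ :=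
  ∑' T : SetValuedTableau μ, MvPowerSeries.monomial T.weight ((-1 : ℤ) ^ (T.size - μ.card))

/-! ### Dominoes and pavings -/

/-- A domino, given by its top left box `(row, col)` and its orientation. -/
@[ext]
structure Domino where
  row : ℕ
  col : ℕ
  horizontal : Bool
  deriving DecidableEq

/-- The content `j - i` of the box `(i, j)`: the box is crossed by the diagonal `D_{j-i}`. -/
def boxContent (c : ℕ × ℕ) : ℤ := (c.2 : ℤ) - (c.1 : ℤ)

namespace Domino

/-- The box of a domino other than its top left one. -/
def secondBox (F : Domino) : ℕ × ℕ :=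
  if F.horizontal then (F.row, F.col + 1) else (F.row + 1, F.col)

/-- The two boxes of a domino. -/
def boxes (F : Domino) : Finset (ℕ × ℕ) := {(F.row, F.col), F.secondBox}

/-- The domino `F` is located on the diagonal `D_{2k}`: this diagonal crosses one of its boxes
along the diagonal of that box. The boxes of `F` have consecutive contents, so there is exactly one
such `k`. -/
def OnDiagonal (F : Domino) (k : ℤ) : Prop := ∃ c ∈ F.boxes, boxContent c = 2 * k

/-- Type 1: the small triangle cut from the domino by its diagonal `D_{2k}` points upward, i.e.
the box not crossed by `D_{2k}` lies below that diagonal (it has content `2k - 1`). -/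
def IsType1 (F : Domino) : Prop := ∃ k, F.OnDiagonal k ∧ ∃ c ∈ F.boxes, boxContent c = 2 * k - 1

/-- Type 2: the small triangle cut from the domino by its diagonal `D_{2k}` points downward, i.e.
the box not crossed by `D_{2k}` lies above that diagonal (it has content `2k + 1`). -/
def IsType2 (F : Domino) : Prop := ∃ k, F.OnDiagonal k ∧ ∃ c ∈ F.boxes, boxContent c = 2 * k + 1

def SameType (F₁ F₂ : Domino) : Prop :=
  (F₁.IsType1 ∧ F₂.IsType1) ∨ (F₁.IsType2 ∧ F₂.IsType2)

/-- `F₂` is weakly southeast of `F₁`: some box of `F₂` is weakly southeast of the top left box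
of `F₁`. -/
def WeaklySoutheast (F₁ F₂ : Domino) : Prop := ∃ c ∈ F₂.boxes, F₁.row ≤ c.1 ∧ F₁.col ≤ c.2

theorem card_boxes (F : Domino) : F.boxes.card = 2 := by
  refine Finset.card_pair ?_
  unfold secondBox
  split_ifs <;> simp [Prod.ext_iff]

end Domino

/-- A domino paving of `lam`: a set of pairwise disjoint dominoes whose union is `lam`. -/
@[ext]
structure DominoPaving (lam : YoungDiagram) where
  dominoes : Finset Domino
  disjoint : ∀ F₁ ∈ dominoes, ∀ F₂ ∈ dominoes, F₁ ≠ F₂ → Disjoint F₁.boxes F₂.boxes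
  cover : dominoes.biUnion Domino.boxes = lam.cells

/-- A partition is pavable if it has a domino paving. -/
def Pavable (lam : YoungDiagram) : Prop := Nonempty (DominoPaving lam)

/-- A paving of `lam` has `|lam| / 2` dominoes. -/
theorem DominoPaving.card_eq {lam : YoungDiagram} (P : DominoPaving lam) :
    lam.card = 2 * P.dominoes.card := by
  rw [YoungDiagram.card, ← P.cover,
    Finset.card_biUnion fun F₁ h₁ F₂ h₂ hne => P.disjoint F₁ h₁ F₂ h₂ hne,
    Finset.sum_congr rfl fun F _ => F.card_boxes]
  simp [mul_comm]

/-! ### Domino tableaux and set-valued domino tableaux -/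

/-- The filling `f` of the dominoes of the paving `P` is a domino tableau: entries weakly increase
from left to right along rows and strictly increase from top to bottom down columns (where of
course the two boxes of a single domino are not compared with each other). -/
def IsDominoTableau {lam : YoungDiagram} {α : Type*} [Preorder α] (P : DominoPaving lam)
    (f : Domino → α) : Prop :=
  ∀ F₁ ∈ P.dominoes, ∀ F₂ ∈ P.dominoes, F₁ ≠ F₂ →
    (∀ i j₁ j₂, (i, j₁) ∈ F₁.boxes → (i, j₂) ∈ F₂.boxes → j₁ < j₂ → f F₁ ≤ f F₂) ∧
    (∀ i₁ i₂ j, (i₁, j) ∈ F₁.boxes → (i₂, j) ∈ F₂.boxes → i₁ < i₂ → f F₁ < f F₂)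

/-- A set-valued domino tableau of shape `lam`. The domino `F` of the paving is filled with
`entry F`; off the paving the value of `entry` is fixed to be `∅`, so that equal tableaux are equal
terms. -/
@[ext]
structure SetValuedDominoTableau (lam : YoungDiagram) where
  paving : DominoPaving lam
  entry : Domino → Finset ℕ+
  nonempty : ∀ F ∈ paving.dominoes, (entry F).Nonempty
  empty_outside : ∀ F, F ∉ paving.dominoes → entry F = ∅
  /-- The minima form a domino tableau (`Finset.min` of a nonempty set is its least element). -/
  min_isDominoTableau : IsDominoTableau paving fun F => (entry F).min
  weak : ∀ F₁ ∈ paving.dominoes, ∀ F₂ ∈ paving.dominoes,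
    F₁.SameType F₂ → F₁.WeaklySoutheast F₂ →
      ∀ k, F₁.OnDiagonal k → F₂.OnDiagonal (k + 1) → SetLE (entry F₁) (entry F₂)
  strict : ∀ F₁ ∈ paving.dominoes, ∀ F₂ ∈ paving.dominoes,
    F₁.SameType F₂ → F₁.WeaklySoutheast F₂ →
      ∀ k, F₁.OnDiagonal (k + 1) → F₂.OnDiagonal k → SetLT (entry F₁) (entry F₂)

namespace SetValuedDominoTableau

variable {lam : YoungDiagram}

/-- `|T|`: the total number of integers in the filling. -/
def size (T : SetValuedDominoTableau lam) : ℕ := ∑ F ∈ T.paving.dominoes, (T.entry F).card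

/-- The exponent of `x^T`: the exponent of `x_i` is the number of dominoes whose set
contains `i`. -/
noncomputable def weight (T : SetValuedDominoTableau lam) : ℕ+ →₀ ℕ :=
  ∑ F ∈ T.paving.dominoes, ∑ i ∈ T.entry F, Finsupp.single i 1

/-- `|lam| / 2 ≤ |T|`, so the natural-number subtraction `|T| - |lam| / 2` never truncates. -/
theorem half_card_le_size (T : SetValuedDominoTableau lam) : lam.card / 2 ≤ T.size := by
  have h : ∑ _F ∈ T.paving.dominoes, 1 ≤ T.size :=
    Finset.sum_le_sum fun F hF => (T.nonempty F hF).card_pos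
  have h2 := T.paving.card_eq
  simp only [Finset.sum_const, smul_eq_mul, mul_one] at h
  omega

end SetValuedDominoTableau

/-! ### The 2-quotient -/

/-- The sequence `L` of `λ = (λ_1, …, λ_k)`: `l_i = λ_i + k - i`, where `k - i` is the number of
components to the right of the `i`-th one. -/
def betaSequence : List ℕ → List ℕ
  | [] => []
  | a :: w => (a + w.length) :: betaSequence w

/-- Given the components of `L` of parity `r` (`r = 0` or `1`), from left to right, subtract
the corresponding components of `M`, which are `r, r + 2, r + 4, …` from right to left, and divide
by `2`. -/
def subtractHalve (r : ℕ) : List ℕ → List ℕ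
  | [] => []
  | a :: w => (a - (2 * w.length + r)) / 2 :: subtractHalve r w

/-- The list of parts of one component of the 2-quotient of the partition with parts `w`:
the first component for `r = 0` (even components of `L`), the second one for `r = 1` (odd
components of `L`). Zero components are deleted. -/
def quotientParts (r : ℕ) (w : List ℕ) : List ℕ :=
  (subtractHalve r ((betaSequence w).filter fun a => a % 2 = r)).filter fun a => a ≠ 0

theorem le_of_mem_betaSequence {a : ℕ} {w : List ℕ} (h : ∀ b ∈ w, b ≤ a) :
    ∀ c ∈ betaSequence w, c < a + w.length := by
  induction w with
  | nil => simp [betaSequence]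
  | cons b w ih =>
    intro c hc
    simp only [betaSequence, List.mem_cons] at hc
    rcases hc with rfl | hc
    · have := h b (by simp)
      simp only [List.length_cons]
      omega
    · have := ih (fun b hb => h b (by simp [hb])) c hc
      simp only [List.length_cons]
      omega

theorem pairwise_betaSequence {w : List ℕ} (h : w.Pairwise (· ≥ ·)) :
    (betaSequence w).Pairwise (· > ·) := by
  induction w with
  | nil => simp [betaSequence]
  | cons a w ih =>
    rw [List.pairwise_cons] at h
    rw [betaSequence, List.pairwise_cons]
    exact ⟨fun c hc => le_of_mem_betaSequence h.1 c hc, ih h.2⟩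

theorem pairwise_subtractHalve {r : ℕ} {w : List ℕ} (h : w.Pairwise (· > ·))
    (hr : ∀ a ∈ w, a % 2 = r) :
    (subtractHalve r w).Pairwise (· ≥ ·) ∧
      ∀ b, (∀ a ∈ w, a < b) → b % 2 = r →
        ∀ c ∈ subtractHalve r w, c ≤ (b - (2 * w.length + r)) / 2 := by
  induction w with
  | nil => simp [subtractHalve]
  | cons a w ih =>
    rw [List.pairwise_cons] at h
    obtain ⟨h1, h2⟩ := ih h.2 fun x hx => hr x (by simp [hx])
    have ha := hr a (by simp)
    have h3 := h2 a h.1 ha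
    refine ⟨?_, fun b hb hbr c hc => ?_⟩
    · rw [subtractHalve, List.pairwise_cons]
      exact ⟨h3, h1⟩
    · have hab := hb a (by simp)
      have hc' : c ≤ (a - (2 * w.length + r)) / 2 := by
        simp only [subtractHalve, List.mem_cons] at hc
        rcases hc with rfl | hc
        · exact le_rfl
        · exact h3 c hc
      simp only [List.length_cons]
      omega

theorem sortedGE_quotientParts (r : ℕ) {w : List ℕ} (h : w.SortedGE) :
    (quotientParts r w).SortedGE := by
  refine List.Pairwise.sortedGE (List.Pairwise.filter _ (pairwise_subtractHalve
    (List.Pairwise.filter _ (pairwise_betaSequence h.pairwise)) ?_).1)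
  intro a ha
  simpa using (List.mem_filter.1 ha).2

/-- The 2-quotient `(μ, ν)` of a partition. -/
def twoQuotient (lam : YoungDiagram) : YoungDiagram × YoungDiagram :=
  (YoungDiagram.ofRowLens (quotientParts 0 lam.rowLens)
      (sortedGE_quotientParts 0 lam.rowLens_sorted),
    YoungDiagram.ofRowLens (quotientParts 1 lam.rowLens)
      (sortedGE_quotientParts 1 lam.rowLens_sorted))

/-!
The proof is a bijection between set-valued domino tableaux of shape `λ` and pairs of set-valued
tableaux of shapes `μ` and `ν` that preserves the signed monomials.

Reading a tableau in the order of increasing minima, from left to right among equal minima, builds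
its shape box by box or domino by domino. In the picture of beads on a line, adding a box of content
`q` moves a bead by one step across `q`, and adding a domino moves a bead by two steps. A bead that
moves by two steps stays on the positions of one parity, so a domino tableau is a shuffle of two
independent processes, each of which grows an ordinary tableau. Since the order of the moves is
determined by the keys (minimum, position), nothing is lost by recording only the finite set of
moves `(p, A)`, position and filling; shuffling then becomes the disjoint union of sets.

`IsMoveSystem` describes the sets of moves that occur. The three bijections are
`SetValuedTableau.movesEquiv` (tableaux are systems of moves on one parity class),
`SetValuedDominoTableau.movesEquiv` (domino tableaux are systems of moves) and
`IsMoveSystem.splitEquiv` (a system splits into its even and its odd part). In both inverse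
directions, the box or domino of a move is recovered by counting the earlier moves on its diagonals:
along a fixed diagonal, boxes are added in order, so ranks are places on the diagonal. The local
conditions on set-valued domino tableaux compare dominoes of equal type on neighbouring diagonals.
Two such dominoes always have boxes of adjacent contents, which are comparable, so that being weakly
southeast means being added later, exactly as for boxes of a tableau on neighbouring diagonals.

It remains to compare shapes. A diagram is determined by its beads `λ_i - i`. The definition of the
2-quotient says that the beads of `μ` and `ν` are the beads of `λ` at the positions of either
parity, up to shifts; the shifts are the right ones because a pavable `λ` has as many boxes of even
content as of odd content (`Pavable.length_filter_betaSequence`). Hence the lengths of the diagonals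
of `λ`, `μ` and `ν` fit together (`Pavable.exists_spreadCount`). Which of `μ` and `ν` belongs to the
even positions depends on the parity of the number of rows of `λ`, but the product is symmetric.
-/

/-! ### Moves, their order, and ranks -/

/-- A move `(p, A)`: it stands for a box or a domino at position `p` filled with the set `A`. In
terms of beads on a line, it moves a bead from position `p` to position `p + 2`. -/
abbrev Move := ℤ × Finset ℕ+

/-- Moves are carried out in the order of increasing minima, from left to right among moves with
equal minima. -/
def moveKey (x : Move) : WithTop ℕ+ ×ₗ ℤ := toLex (x.2.min, x.1)

/-- The number of moves of `X` carried out before time `t`. -/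
def moveRank (X : Finset Move) (t : WithTop ℕ+ ×ₗ ℤ) : ℕ := (X.filter fun x => moveKey x < t).card

/-- The moves of `S` at position `p`. -/
def movesAt (S : Finset Move) (p : ℤ) : Finset Move := S.filter fun x => x.1 = p

/-- The time right after a move with key `t`. -/
def nextTime (t : WithTop ℕ+ ×ₗ ℤ) : WithTop ℕ+ ×ₗ ℤ := toLex ((ofLex t).1, (ofLex t).2 + 1)

/-- A time after all moves with nonempty sets. -/
def endTime : WithTop ℕ+ ×ₗ ℤ := toLex (⊤, 0)

theorem moveKey_lt_iff {x y : Move} :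
    moveKey x < moveKey y ↔ x.2.min < y.2.min ∨ x.2.min = y.2.min ∧ x.1 < y.1 :=
  Prod.Lex.toLex_lt_toLex

theorem lt_nextTime_iff {s t : WithTop ℕ+ ×ₗ ℤ} : s < nextTime t ↔ s ≤ t := by
  rw [Prod.Lex.lt_iff, Prod.Lex.le_iff]
  simp [nextTime]

theorem moveKey_lt_endTime {x : Move} (h : x.2.Nonempty) : moveKey x < endTime := by
  obtain ⟨a, ha⟩ := Finset.min_of_nonempty h
  refine Prod.Lex.toLex_lt_toLex.2 (Or.inl ?_)
  rw [ha]
  exact WithTop.coe_lt_top a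

theorem fst_eq_of_moveKey_eq {x y : Move} (h : moveKey x = moveKey y) : x.1 = y.1 :=
  congrArg (fun t => (ofLex t).2) h

theorem moveRank_le_card (X : Finset Move) (t) : moveRank X t ≤ X.card :=
  Finset.card_filter_le _ _

theorem moveRank_mono (X : Finset Move) : Monotone (moveRank X) := fun _ _ h =>
  Finset.card_le_card (Finset.monotone_filter_right _ fun _ _ hx => hx.trans_le h)

theorem moveRank_lt_moveRank_iff {X : Finset Move} {x : Move} (hx : x ∈ X) {t} :
    moveRank X (moveKey x) < moveRank X t ↔ moveKey x < t := by
  refine ⟨fun h => ?_, fun h => ?_⟩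
  · by_contra h'
    exact absurd (moveRank_mono X (not_lt.1 h')) (not_le.2 h)
  · refine Finset.card_lt_card ⟨?_, fun h' => ?_⟩
    · exact Finset.monotone_filter_right _ fun _ _ hx => hx.trans h
    · have := h' (Finset.mem_filter.2 ⟨hx, h⟩)
      exact lt_irrefl _ (Finset.mem_filter.1 this).2

theorem moveRank_lt_card {X : Finset Move} {x : Move} (hx : x ∈ X) :
    moveRank X (moveKey x) < X.card :=
  ((moveRank_lt_moveRank_iff hx).2 (lt_nextTime_iff.2 le_rfl)).trans_le (moveRank_le_card _ _)

theorem moveKey_eq_of_moveRank_eq {X : Finset Move} {x y : Move} (hx : x ∈ X) (hy : y ∈ X)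
    (h : moveRank X (moveKey x) = moveRank X (moveKey y)) : moveKey x = moveKey y := by
  rcases lt_trichotomy (moveKey x) (moveKey y) with h' | h' | h'
  · exact absurd h ((moveRank_lt_moveRank_iff hx).2 h').ne
  · exact h'
  · exact absurd h ((moveRank_lt_moveRank_iff hy).2 h').ne'

theorem exists_moveRank_eq {X : Finset Move} (hX : Set.InjOn moveKey X) {i : ℕ}
    (hi : i < X.card) : ∃ x ∈ X, moveRank X (moveKey x) = i := by
  have := Finset.surj_on_of_inj_on_of_card_le (s := X) (t := Finset.range X.card)
    (fun x _ => moveRank X (moveKey x)) (fun x hx => Finset.mem_range.2 (moveRank_lt_card hx))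
    (fun x y hx hy h => hX hx hy (moveKey_eq_of_moveRank_eq hx hy h)) (by simp)
    i (Finset.mem_range.2 hi)
  obtain ⟨x, hx, h⟩ := this
  exact ⟨x, hx, h.symm⟩

theorem mem_movesAt {S : Finset Move} {p : ℤ} {x : Move} : x ∈ movesAt S p ↔ x ∈ S ∧ x.1 = p :=
  Finset.mem_filter

theorem moveRank_endTime {X : Finset Move} (h : ∀ x ∈ X, x.2.Nonempty) :
    moveRank X endTime = X.card := by
  rw [moveRank, Finset.filter_true_of_mem fun x hx => moveKey_lt_endTime (h x hx)]

theorem min_le_min_of_setLE {A B : Finset ℕ+} (hA : A.Nonempty) (h : SetLE A B) :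
    A.min ≤ B.min := by
  obtain ⟨a, ha⟩ := hA
  exact Finset.le_min fun b hb => (Finset.min_le ha).trans (WithTop.coe_le_coe.2 (h a ha b hb))

theorem min_lt_min_of_setLT {A B : Finset ℕ+} (hA : A.Nonempty) (hB : B.Nonempty)
    (h : SetLT A B) : A.min < B.min := by
  obtain ⟨a, ha⟩ := hA
  obtain ⟨b, hb⟩ := Finset.min_of_nonempty hB
  rw [hb]
  exact (Finset.min_le ha).trans_lt (WithTop.coe_lt_coe.2 (h a ha b (Finset.mem_of_min hb)))

theorem SetLE.trans {A B C : Finset ℕ+} (hB : B.Nonempty) (h : SetLE A B) (h' : SetLE B C) :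
    SetLE A C := fun a ha c hc => by
  obtain ⟨b, hb⟩ := hB
  exact (h a ha b hb).trans (h' b hb c hc)

theorem SetLT.trans {A B C : Finset ℕ+} (hB : B.Nonempty) (h : SetLT A B) (h' : SetLT B C) :
    SetLT A C := fun a ha c hc => by
  obtain ⟨b, hb⟩ := hB
  exact (h a ha b hb).trans (h' b hb c hc)

/-! ### Profiles of Young diagrams along diagonals -/

/-- A profile records for each content `p` the row `h p` of the first box of content `p` outside
of a Young diagram. Going one diagonal to the left, this row stays or goes down by one. -/
def IsProfile (h : ℤ → ℕ) : Prop := ∀ p, h p ≤ h (p - 1) ∧ h (p - 1) ≤ h p + 1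

theorem IsProfile.antitone {h : ℤ → ℕ} (H : IsProfile h) : Antitone h :=
  antitone_int_of_succ_le fun p => by simpa using (H (p + 1)).1

theorem IsProfile.monotone_add {h : ℤ → ℕ} (H : IsProfile h) : Monotone fun p => (h p : ℤ) + p :=
  monotone_int_of_le_succ fun p => by
    have := (H (p + 1)).2
    simp only [add_sub_cancel_right] at this
    omega

/-- The boxes strictly above a profile form a lower set. -/
theorem IsProfile.lt_of_le {h : ℤ → ℕ} (H : IsProfile h) {i j i' j' : ℕ} (hi : i ≤ i')
    (hj : j ≤ j') (h' : i' < h (boxContent (i', j'))) : i < h (boxContent (i, j)) := by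
  rcases le_total (boxContent (i, j)) (boxContent (i', j')) with hc | hc
  · have := H.antitone hc
    omega
  · have := H.monotone_add hc
    simp only [boxContent] at this h' ⊢
    omega

/-- Two boxes on the same diagonal are comparable. -/
theorem le_total_of_boxContent_eq {c c' : ℕ × ℕ} (h : boxContent c = boxContent c') :
    c ≤ c' ∨ c' ≤ c := by
  simp only [boxContent, Prod.le_def] at *
  omega

/-- The number of boxes of content `p`. -/
def diagCount (μ : YoungDiagram) (p : ℤ) : ℕ := (μ.cells.filter fun c => boxContent c = p).card

/-- The boxes of content `p` lie in the rows from `(-p).toNat` to `diagRow μ p - 1`. -/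
def diagRow (μ : YoungDiagram) (p : ℤ) : ℕ := (-p).toNat + diagCount μ p

theorem mem_iff_lt_add_card {R : Finset ℕ} {b : ℕ} (hb : ∀ i ∈ R, b ≤ i)
    (hR : ∀ i ∈ R, ∀ i', b ≤ i' → i' ≤ i → i' ∈ R) (i : ℕ) :
    i ∈ R ↔ b ≤ i ∧ i < b + R.card := by
  refine ⟨fun h => ⟨hb i h, ?_⟩, fun ⟨h1, h2⟩ => ?_⟩
  · have := Finset.card_le_card (s := Finset.Icc b i) (t := R) fun i' hi' =>
      hR i h i' (Finset.mem_Icc.1 hi').1 (Finset.mem_Icc.1 hi').2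
    have hb := hb i h
    rw [Nat.card_Icc] at this
    omega
  · by_contra h
    have := Finset.card_le_card (s := R) (t := Finset.Ico b i) fun i' hi' =>
      Finset.mem_Ico.2 ⟨hb i' hi', lt_of_not_ge fun h' => h (hR i' hi' i h1 h')⟩
    rw [Nat.card_Ico] at this
    omega

theorem mem_iff_lt_diagRow {μ : YoungDiagram} {i j : ℕ} :
    (i, j) ∈ μ ↔ i < diagRow μ (boxContent (i, j)) := by
  set p := boxContent (i, j) with hp
  set C := μ.cells.filter fun c => boxContent c = p
  have hinj : Set.InjOn Prod.fst (C : Set (ℕ × ℕ)) := by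
    rintro ⟨a, b⟩ h ⟨c, d⟩ h' hac
    have h := (Finset.mem_filter.1 h).2
    have h' := (Finset.mem_filter.1 h').2
    simp only [boxContent] at h h' hac
    ext <;> simp <;> omega
  have key := mem_iff_lt_add_card (R := C.image Prod.fst) (b := (-p).toNat) ?_ ?_ i
  · rw [Finset.card_image_of_injOn hinj] at key
    rw [diagRow, diagCount]
    have h1 : (i, j) ∈ μ ↔ i ∈ C.image Prod.fst := by
      rw [Finset.mem_image]
      refine ⟨fun h => ⟨(i, j), Finset.mem_filter.2 ⟨(YoungDiagram.mem_cells _).2 h, rfl⟩, rfl⟩, ?_⟩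
      rintro ⟨⟨a, b⟩, h, rfl⟩
      obtain ⟨h, h'⟩ := Finset.mem_filter.1 h
      have : b = j := by simp only [hp, boxContent] at h'; omega
      exact this ▸ (YoungDiagram.mem_cells _).1 h
    rw [h1, key]
    simp only [hp, boxContent]
    constructor
    · exact fun h => h.2
    · exact fun h => ⟨by omega, h⟩
  · intro i' hi'
    obtain ⟨⟨a, b⟩, h, rfl⟩ := Finset.mem_image.1 hi'
    have h' := (Finset.mem_filter.1 h).2
    simp only [boxContent] at h' ⊢
    omega
  · intro i' hi' i'' h1 h2
    obtain ⟨⟨a, b⟩, h, rfl⟩ := Finset.mem_image.1 hi'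
    obtain ⟨h, h'⟩ := Finset.mem_filter.1 h
    refine Finset.mem_image.2 ⟨(i'', (i'' + p).toNat), Finset.mem_filter.2 ⟨?_, ?_⟩, rfl⟩
    · refine (YoungDiagram.mem_cells _).2 (μ.up_left_mem h2 ?_ ((YoungDiagram.mem_cells _).1 h))
      simp only [boxContent] at h'
      omega
    · simp only [boxContent]
      omega

theorem isProfile_diagRow (μ : YoungDiagram) : IsProfile (diagRow μ) := by
  intro p
  have hb (p : ℤ) : (-p).toNat ≤ diagRow μ p := Nat.le_add_right _ _
  have h0 := hb p
  have h1 := hb (p - 1)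
  constructor <;> by_contra! h
  · have hm := @mem_iff_lt_diagRow μ (diagRow μ (p - 1)) (diagRow μ (p - 1) + p).toNat
    have hm' := @mem_iff_lt_diagRow μ (diagRow μ (p - 1)) (diagRow μ (p - 1) + p - 1).toNat
    rw [show boxContent (diagRow μ (p - 1), (diagRow μ (p - 1) + p).toNat) = p by
      simp only [boxContent]; omega] at hm
    rw [show boxContent (diagRow μ (p - 1), (diagRow μ (p - 1) + p - 1).toNat) = p - 1 by
      simp only [boxContent]; omega] at hm'
    exact lt_irrefl _ (hm'.1 (μ.up_left_mem le_rfl (by omega) (hm.2 h)))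
  · have hm := @mem_iff_lt_diagRow μ (diagRow μ p) (diagRow μ p + p).toNat
    have hm' := @mem_iff_lt_diagRow μ (diagRow μ p + 1) (diagRow μ p + p).toNat
    rw [show boxContent (diagRow μ p, (diagRow μ p + p).toNat) = p by
      simp only [boxContent]; omega] at hm
    rw [show boxContent (diagRow μ p + 1, (diagRow μ p + p).toNat) = p - 1 by
      simp only [boxContent]; omega] at hm'
    exact lt_irrefl _ (hm.1 (μ.up_left_mem (by omega) le_rfl (hm'.2 h)))

/-- The boxes of a Young diagram that satisfy a condition inherited by boxes further up and left. -/
def subdiagram (μ : YoungDiagram) (P : ℕ × ℕ → Prop) [DecidablePred P]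
    (hP : ∀ c c', c ≤ c' → c' ∈ μ → P c' → P c) : YoungDiagram where
  cells := μ.cells.filter P
  isLowerSet := by
    intro c' c hc h
    obtain ⟨h1, h2⟩ := Finset.mem_filter.1 h
    exact Finset.mem_filter.2 ⟨μ.isLowerSet hc h1, hP c c' hc h1 h2⟩

/-! ### Systems of moves -/

/-- Initially, the beads occupy the positions `p ≤ 0`. -/
def initialBead (p : ℤ) : ℕ := if p ≤ 0 then 1 else 0

/-- A system of moves with `N p` moves at position `p`: starting from beads at the positions
`p ≤ 0`, the moves, carried out in the order of their keys, always move a bead to an empty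
position (by `occ_nonneg` and `occ_le_one`, at each time `t` the number of beads at `p`, which is
`initialBead p` plus arrivals from `p - 2` minus departures from `p`, is `0` or `1`), and the sets of moves at positions of distance `2` compare like those of adjacent diagonals
of a set-valued tableau. Positions of different parity do not interact. -/
structure IsMoveSystem (N : ℤ → ℕ) (S : Finset Move) : Prop where
  nonempty : ∀ x ∈ S, x.2.Nonempty
  key_inj : Set.InjOn moveKey S
  occ_nonneg : ∀ t p,
    moveRank (movesAt S p) t ≤ moveRank (movesAt S (p - 2)) t + initialBead p
  occ_le_one : ∀ t p,
    moveRank (movesAt S (p - 2)) t + initialBead p ≤ moveRank (movesAt S p) t + 1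
  weak : ∀ x ∈ S, ∀ y ∈ S, moveKey x < moveKey y → y.1 = x.1 + 2 → SetLE x.2 y.2
  strict : ∀ x ∈ S, ∀ y ∈ S, moveKey x < moveKey y → y.1 = x.1 - 2 → SetLT x.2 y.2
  card_movesAt : ∀ p, (movesAt S p).card = N p

theorem initialBead_le_one (p : ℤ) : initialBead p ≤ 1 := by
  unfold initialBead; split_ifs <;> simp

/-- Restricting a system of moves to the positions of one parity (more generally, to a set `P` of
positions invariant under shifts by `2`) gives a system of moves. -/
theorem IsMoveSystem.filter {N : ℤ → ℕ} {S : Finset Move} (h : IsMoveSystem N S) (P : ℤ → Prop)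
    [DecidablePred P] (hP : ∀ p, P (p - 2) ↔ P p) :
    IsMoveSystem (fun p => if P p then N p else 0) (S.filter fun x => P x.1) := by
  have h1 (p) (hp : P p) : movesAt (S.filter fun x => P x.1) p = movesAt S p := by
    ext x; simp only [mem_movesAt, Finset.mem_filter]
    constructor
    · exact fun h => ⟨h.1.1, h.2⟩
    · exact fun h => ⟨⟨h.1, h.2 ▸ hp⟩, h.2⟩
  have h2 (p) (hp : ¬ P p) : movesAt (S.filter fun x => P x.1) p = ∅ := by
    ext x; simp only [mem_movesAt, Finset.mem_filter, Finset.notMem_empty, iff_false]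
    exact fun h => hp (h.2 ▸ h.1.2)
  have hs : S.filter (fun x => P x.1) ⊆ S := Finset.filter_subset _ _
  refine ⟨fun x hx => h.nonempty x (hs hx), h.key_inj.mono hs, fun t p => ?_, fun t p => ?_,
    fun x hx y hy => h.weak x (hs hx) y (hs hy), fun x hx y hy => h.strict x (hs hx) y (hs hy),
    fun p => ?_⟩
  · by_cases hp : P p
    · rw [h1 p hp, h1 _ ((hP p).2 hp)]; exact h.occ_nonneg t p
    · rw [h2 p hp]; simp [moveRank]
  · by_cases hp : P p
    · rw [h1 p hp, h1 _ ((hP p).2 hp)]; exact h.occ_le_one t p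
    · rw [h2 p hp, h2 _ fun h => hp ((hP p).1 h)]; simpa [moveRank] using initialBead_le_one p
  · by_cases hp : P p
    · rw [h1 p hp, if_pos hp]; exact h.card_movesAt p
    · rw [h2 p hp, if_neg hp]; rfl

theorem IsMoveSystem.fst_ne {N : ℤ → ℕ} {S : Finset Move} (h : IsMoveSystem N S) {p : ℤ}
    (hp : N p = 0) {x : Move} (hx : x ∈ S) : x.1 ≠ p := by
  intro hxp
  have := h.card_movesAt p
  rw [hp, Finset.card_eq_zero] at this
  exact Finset.notMem_empty x (this ▸ mem_movesAt.2 ⟨hx, hxp⟩)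

theorem IsMoveSystem.union {N₁ N₂ : ℤ → ℕ} {S₁ S₂ : Finset Move} (h₁ : IsMoveSystem N₁ S₁)
    (h₂ : IsMoveSystem N₂ S₂) (hN₁ : ∀ p, ¬ Even p → N₁ p = 0) (hN₂ : ∀ p, Even p → N₂ p = 0) :
    IsMoveSystem (N₁ + N₂) (S₁ ∪ S₂) := by
  have e₁ : ∀ x ∈ S₁, Even x.1 := fun x hx => by
    by_contra h; exact h₁.fst_ne (hN₁ _ h) hx rfl
  have e₂ : ∀ x ∈ S₂, ¬ Even x.1 := fun x hx h => h₂.fst_ne (hN₂ _ h) hx rfl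
  have m₁ (p) (hp : Even p) : movesAt (S₁ ∪ S₂) p = movesAt S₁ p := by
    ext x; simp only [mem_movesAt, Finset.mem_union]
    refine ⟨?_, fun h => ⟨Or.inl h.1, h.2⟩⟩
    rintro ⟨h | h, rfl⟩
    · exact ⟨h, rfl⟩
    · exact absurd hp (e₂ x h)
  have m₂ (p) (hp : ¬ Even p) : movesAt (S₁ ∪ S₂) p = movesAt S₂ p := by
    ext x; simp only [mem_movesAt, Finset.mem_union]
    refine ⟨?_, fun h => ⟨Or.inr h.1, h.2⟩⟩
    rintro ⟨h | h, rfl⟩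
    · exact absurd (e₁ x h) hp
    · exact ⟨h, rfl⟩
  have hP (p : ℤ) : Even (p - 2) ↔ Even p := by simp
  have hP' (p : ℤ) : Even (p + 2) ↔ Even p := by simp
  refine ⟨fun x hx => ?_, fun x hx y hy hxy => ?_, fun t p => ?_, fun t p => ?_,
    fun x hx y hy hlt hxy => ?_, fun x hx y hy hlt hxy => ?_, fun p => ?_⟩
  · rcases Finset.mem_union.1 hx with hx | hx
    · exact h₁.nonempty x hx
    · exact h₂.nonempty x hx
  · have hp := fst_eq_of_moveKey_eq hxy
    rcases Finset.mem_union.1 hx with hx | hx <;> rcases Finset.mem_union.1 hy with hy | hy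
    · exact h₁.key_inj hx hy hxy
    · exact absurd (hp ▸ e₁ x hx) (e₂ y hy)
    · exact absurd (hp ▸ e₁ y hy) (e₂ x hx)
    · exact h₂.key_inj hx hy hxy
  · by_cases hp : Even p
    · rw [m₁ p hp, m₁ _ ((hP p).2 hp)]; exact h₁.occ_nonneg t p
    · rw [m₂ p hp, m₂ _ fun h => hp ((hP p).1 h)]; exact h₂.occ_nonneg t p
  · by_cases hp : Even p
    · rw [m₁ p hp, m₁ _ ((hP p).2 hp)]; exact h₁.occ_le_one t p
    · rw [m₂ p hp, m₂ _ fun h => hp ((hP p).1 h)]; exact h₂.occ_le_one t p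
  · rcases Finset.mem_union.1 hx with hx | hx <;> rcases Finset.mem_union.1 hy with hy | hy
    · exact h₁.weak x hx y hy hlt hxy
    · exact absurd (hxy ▸ (hP' _).2 (e₁ x hx)) (e₂ y hy)
    · exact absurd ((hP' _).1 (hxy ▸ e₁ y hy)) (e₂ x hx)
    · exact h₂.weak x hx y hy hlt hxy
  · rcases Finset.mem_union.1 hx with hx | hx <;> rcases Finset.mem_union.1 hy with hy | hy
    · exact h₁.strict x hx y hy hlt hxy
    · exact absurd (hxy ▸ (hP _).2 (e₁ x hx)) (e₂ y hy)
    · exact absurd ((hP _).1 (hxy ▸ e₁ y hy)) (e₂ x hx)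
    · exact h₂.strict x hx y hy hlt hxy
  · by_cases hp : Even p
    · rw [m₁ p hp, Pi.add_apply, hN₂ p hp, add_zero]; exact h₁.card_movesAt p
    · rw [m₂ p hp, Pi.add_apply, hN₁ p hp, zero_add]; exact h₂.card_movesAt p

/-- Positions of different parity do not interact: a system of moves is a pair of systems, one at
even and one at odd positions. -/
def IsMoveSystem.splitEquiv {N₁ N₂ : ℤ → ℕ} (hN₁ : ∀ p, ¬ Even p → N₁ p = 0)
    (hN₂ : ∀ p, Even p → N₂ p = 0) :
    {S // IsMoveSystem N₁ S} × {S // IsMoveSystem N₂ S} ≃ {S // IsMoveSystem (N₁ + N₂) S} where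
  toFun S := ⟨S.1.1 ∪ S.2.1, S.1.2.union S.2.2 hN₁ hN₂⟩
  invFun S := (⟨S.1.filter fun x => Even x.1, by
      convert S.2.filter (fun p => Even p) fun p => by simp using 2 with p
      by_cases hp : Even p
      · simp [hp, hN₂]
      · simp [hp, hN₁]⟩,
    ⟨S.1.filter fun x => ¬ Even x.1, by
      convert S.2.filter (fun p => ¬ Even p) fun p => by simp using 2 with p
      by_cases hp : Even p
      · simp [hp, hN₂]
      · simp [hp, hN₁]⟩)
  left_inv S := by
    have e₁ : ∀ x ∈ S.1.1, Even x.1 := fun x hx => by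
      by_contra h; exact S.1.2.fst_ne (hN₁ _ h) hx rfl
    have e₂ : ∀ x ∈ S.2.1, ¬ Even x.1 := fun x hx h => S.2.2.fst_ne (hN₂ _ h) hx rfl
    refine Prod.ext (Subtype.ext ?_) (Subtype.ext ?_) <;> ext x <;>
      simp only [Finset.mem_filter, Finset.mem_union]
    · exact ⟨fun h => h.1.resolve_right fun h' => e₂ x h' h.2, fun h => ⟨Or.inl h, e₁ x h⟩⟩
    · exact ⟨fun h => h.1.resolve_left fun h' => h.2 (e₁ x h'), fun h => ⟨Or.inr h, e₂ x h⟩⟩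
  right_inv S := Subtype.ext (Finset.filter_union_filter_not_eq _ _)

/-! ### Set-valued tableaux as systems of moves -/

theorem moveRank_image {α : Type*} [DecidableEq α] {C : Finset α} {f : α → Move}
    (hf : Set.InjOn f C) (t) :
    moveRank (C.image f) t = (C.filter fun c => moveKey (f c) < t).card := by
  rw [moveRank, Finset.filter_image,
    Finset.card_image_of_injOn (hf.mono (Finset.filter_subset _ _))]

/-- For a weakly increasing labelling `K` of the boxes of a Young diagram, the boxes with labels
below `t` form a Young diagram; this is its profile (see `diagRow`). -/
def profileBefore {κ : Type*} [LinearOrder κ] (μ : YoungDiagram) (K : ℕ × ℕ → κ) (t : κ) (q : ℤ) :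
    ℕ :=
  (-q).toNat + ((μ.cells.filter fun c => boxContent c = q).filter fun c => K c < t).card

section profileBefore

variable {κ : Type*} [LinearOrder κ] {μ : YoungDiagram} {K : ℕ × ℕ → κ}

theorem profileBefore_eq_diagRow (hK : ∀ c c', c ≤ c' → c' ∈ μ → K c ≤ K c') (t : κ) :
    profileBefore μ K t = diagRow (subdiagram μ (fun c => K c < t)
      fun c c' h h' ht => (hK c c' h h').trans_lt ht) := by
  funext q
  rw [profileBefore, diagRow, diagCount, subdiagram, Finset.filter_comm]

theorem isProfile_profileBefore (hK : ∀ c c', c ≤ c' → c' ∈ μ → K c ≤ K c') (t : κ) :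
    IsProfile (profileBefore μ K t) := by
  rw [profileBefore_eq_diagRow hK]
  exact isProfile_diagRow _

theorem lt_profileBefore_iff (hK : ∀ c c', c ≤ c' → c' ∈ μ → K c ≤ K c') {t : κ} {i j : ℕ} :
    i < profileBefore μ K t (boxContent (i, j)) ↔ (i, j) ∈ μ ∧ K (i, j) < t := by
  rw [profileBefore_eq_diagRow hK, ← mem_iff_lt_diagRow]
  exact Finset.mem_filter

/-- The row of a box is read off from the number of earlier boxes on its diagonal. -/
theorem profileBefore_self (hK : ∀ c c', c ≤ c' → c' ∈ μ → K c ≤ K c') {i j : ℕ}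
    (hc : (i, j) ∈ μ) (hlt : ∀ i' j', i = i' + 1 → j = j' + 1 → K (i', j') < K (i, j)) :
    profileBefore μ K (K (i, j)) (boxContent (i, j)) = i := by
  refine le_antisymm (not_lt.1 fun h => lt_irrefl _ ((lt_profileBefore_iff hK).1 h).2) ?_
  rcases i with _ | i
  · exact Nat.zero_le _
  rcases j with _ | j
  · simp only [profileBefore, boxContent]
    omega
  · rw [show boxContent (i + 1, j + 1) = boxContent (i, j) by simp [boxContent]]
    exact (lt_profileBefore_iff hK).2
      ⟨μ.up_left_mem (Nat.le_succ _) (Nat.le_succ _) hc, hlt i j rfl rfl⟩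

end profileBefore

/-- Let `X q` be the moves that add a box of content `q` to a growing diagram. Then
`IsMoveOfBox X c x` says that `x` adds the box `c`: the rank of `x` among the moves of the diagonal
of `c` is the place of `c` on this diagonal. -/
def IsMoveOfBox (X : ℤ → Finset Move) (c : ℕ × ℕ) (x : Move) : Prop :=
  x ∈ X (boxContent c) ∧
    (-boxContent c).toNat + moveRank (X (boxContent c)) (moveKey x) = c.1

namespace IsMoveOfBox

variable {μ : YoungDiagram} {X : ℤ → Finset Move} {c c' : ℕ × ℕ} {x x' : Move}

theorem eq (h : IsMoveOfBox X c x) (h' : IsMoveOfBox X c x')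
    (hX : ∀ q, Set.InjOn moveKey (X q : Set Move)) : x = x' :=
  hX _ h.1 h'.1 (moveKey_eq_of_moveRank_eq h.1 h'.1 (by have := h.2; have := h'.2; omega))

theorem moveKey_le (hX : ∀ t, IsProfile fun q => (-q).toNat + moveRank (X q) t)
    (h : IsMoveOfBox X c x) (h' : IsMoveOfBox X c' x') (hc : c ≤ c') :
    moveKey x ≤ moveKey x' := by
  have hlt : c.1 < (-boxContent c).toNat +
      moveRank (X (boxContent c)) (nextTime (moveKey x')) := by
    refine (hX (nextTime (moveKey x'))).lt_of_le (i := c.1) (j := c.2) (i' := c'.1) (j' := c'.2)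
      hc.1 hc.2 ?_
    have := (moveRank_lt_moveRank_iff h'.1).2 (lt_nextTime_iff.2 (le_refl (moveKey x')))
    have h3 := h'.2
    simp only [Prod.mk.eta] at *
    omega
  rw [← lt_nextTime_iff, ← moveRank_lt_moveRank_iff h.1]
  have := h.2
  omega

theorem mem (hcard : ∀ q, (X q).card = diagCount μ q) (h : IsMoveOfBox X c x) : c ∈ μ := by
  have h1 := moveRank_lt_card h.1
  have h2 := h.2
  rw [hcard] at h1
  exact mem_iff_lt_diagRow.2 (show c.1 < (-boxContent c).toNat + diagCount μ (boxContent c) by omega)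

theorem exists_move (hX : Set.InjOn moveKey (X (boxContent c) : Set Move))
    (hcard : ∀ q, (X q).card = diagCount μ q) (hc : c ∈ μ) : ∃ x, IsMoveOfBox X c x := by
  have h1 : c.1 < (-boxContent c).toNat + diagCount μ (boxContent c) := mem_iff_lt_diagRow.1 hc
  have h2 : (-boxContent c).toNat ≤ c.1 := by simp only [boxContent]; omega
  obtain ⟨x, hx, h⟩ := exists_moveRank_eq (i := c.1 - (-boxContent c).toNat) hX (by
    rw [hcard]; omega)
  exact ⟨x, hx, by omega⟩

theorem exists_box {q : ℤ} (hx : x ∈ X q) : ∃ c, boxContent c = q ∧ IsMoveOfBox X c x := by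
  set i := (-q).toNat + moveRank (X q) (moveKey x) with hi
  have hc : boxContent (i, (i + q).toNat) = q := by simp only [boxContent]; omega
  exact ⟨(i, (i + q).toNat), hc, by rw [IsMoveOfBox, hc]; exact ⟨hx, rfl⟩⟩

end IsMoveOfBox

/-- The number of moves at each position in the system of moves of a tableau of shape `μ`: the
diagonal of content `q` of `μ` is placed at position `2 * q - ε`. Dominoes on `D_{2q}` have position
`2 * q - 1` if they are of type 1 and `2 * q` if they are of type 2, so `ε = 1` and `ε = 0` are the
two relevant cases. -/
def spreadCount (ε : ℤ) (μ : YoungDiagram) (p : ℤ) : ℕ :=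
  if Even (p + ε) then diagCount μ ((p + ε) / 2) else 0

theorem spreadCount_two_mul (ε : ℤ) (μ : YoungDiagram) (q : ℤ) :
    spreadCount ε μ (2 * q - ε) = diagCount μ q := by
  simp [spreadCount]

theorem eq_two_mul_sub_of_even {p ε : ℤ} (h : Even (p + ε)) : ∃ q, p = 2 * q - ε := by
  obtain ⟨q, hq⟩ := h
  exact ⟨q, by omega⟩

theorem initialBead_two_mul {ε : ℤ} (h0 : 0 ≤ ε) (h1 : ε ≤ 1) (q : ℤ) :
    initialBead (2 * q - ε) = initialBead q := by
  unfold initialBead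
  congr 1
  rw [eq_iff_iff]
  omega

theorem toNat_neg_sub_one (q : ℤ) : (-(q - 1)).toNat = (-q).toNat + initialBead q := by
  unfold initialBead
  split_ifs <;> omega

namespace SetValuedTableau

variable {μ : YoungDiagram}

/-- The move of a box. -/
def boxMove (ε : ℤ) (T : SetValuedTableau μ) (c : ℕ × ℕ) : Move := (2 * boxContent c - ε, T.entry c)

/-- The system of moves of a set-valued tableau. -/
def moves (ε : ℤ) (T : SetValuedTableau μ) : Finset Move := μ.cells.image (T.boxMove ε)

theorem moveKey_boxMove_lt (ε : ℤ) (T : SetValuedTableau μ) {c c' : ℕ × ℕ} (h : c ≤ c')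
    (hne : c ≠ c') (hc' : c' ∈ μ) : moveKey (T.boxMove ε c) < moveKey (T.boxMove ε c') := by
  obtain ⟨i, j⟩ := c
  obtain ⟨i', j'⟩ := c'
  obtain ⟨hi, hj⟩ : i ≤ i' ∧ j ≤ j' := h
  have hm : (i, j') ∈ μ := μ.up_left_mem hi le_rfl hc'
  have hm' : (i, j) ∈ μ := μ.up_left_mem le_rfl hj hm
  have h1 : moveKey (T.boxMove ε (i, j)) ≤ moveKey (T.boxMove ε (i, j')) := by
    rcases hj.eq_or_lt with rfl | hj
    · exact le_rfl
    · refine le_of_lt (moveKey_lt_iff.2 ?_)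
      rcases (min_le_min_of_setLE (T.nonempty _ hm') (T.row_weak i j j' hj hm)).lt_or_eq with h | h
      · exact Or.inl h
      · refine Or.inr ⟨h, ?_⟩
        simp only [boxMove, boxContent]
        omega
  have h2 : i < i' → moveKey (T.boxMove ε (i, j')) < moveKey (T.boxMove ε (i', j')) := fun hi =>
    moveKey_lt_iff.2 (Or.inl (min_lt_min_of_setLT (T.nonempty _ hm) (T.nonempty _ hc')
      (T.col_strict i i' j' hi hc')))
  rcases hi.eq_or_lt with rfl | hi
  · refine lt_of_le_of_ne h1 fun h => hne ?_
    have := fst_eq_of_moveKey_eq h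
    simp only [boxMove, boxContent] at this
    rw [Prod.mk.injEq]
    omega
  · exact h1.trans_lt (h2 hi)

theorem moveKey_boxMove_le (ε : ℤ) (T : SetValuedTableau μ) {c c' : ℕ × ℕ} (h : c ≤ c')
    (hc' : c' ∈ μ) : moveKey (T.boxMove ε c) ≤ moveKey (T.boxMove ε c') := by
  by_cases hne : c = c'
  · rw [hne]
  · exact (T.moveKey_boxMove_lt ε h hne hc').le

theorem injOn_moveKey_boxMove (ε : ℤ) (T : SetValuedTableau μ) :
    Set.InjOn (fun c => moveKey (T.boxMove ε c)) (μ.cells : Set (ℕ × ℕ)) := by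
  intro c hc c' hc' h
  have hc : c ∈ μ := hc
  have hc' : c' ∈ μ := hc'
  by_contra hne
  have hq : boxContent c = boxContent c' := by
    have := fst_eq_of_moveKey_eq h
    simp only [boxMove] at this
    omega
  rcases le_total_of_boxContent_eq hq with h' | h'
  · exact (T.moveKey_boxMove_lt ε h' hne hc').ne h
  · exact (T.moveKey_boxMove_lt ε h' (Ne.symm hne) hc).ne h.symm

theorem injOn_boxMove (ε : ℤ) (T : SetValuedTableau μ) :
    Set.InjOn (T.boxMove ε) (μ.cells : Set (ℕ × ℕ)) := fun _ hc _ hc' h =>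
  T.injOn_moveKey_boxMove ε hc hc' (congrArg moveKey h)

theorem movesAt_moves (ε : ℤ) (T : SetValuedTableau μ) (q : ℤ) :
    movesAt (T.moves ε) (2 * q - ε) =
      (μ.cells.filter fun c => boxContent c = q).image (T.boxMove ε) := by
  rw [movesAt, moves, Finset.filter_image]
  congr 1
  refine Finset.filter_congr fun c _ => ?_
  simp only [boxMove]
  omega

theorem movesAt_moves_eq_empty {ε : ℤ} (T : SetValuedTableau μ) {p : ℤ} (hp : ¬ Even (p + ε)) :
    movesAt (T.moves ε) p = ∅ := by
  refine Finset.eq_empty_of_forall_notMem fun x hx => hp ?_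
  obtain ⟨h, hxp⟩ := mem_movesAt.1 hx
  obtain ⟨c, -, rfl⟩ := Finset.mem_image.1 h
  simp [← hxp, boxMove]

theorem moveRank_movesAt_moves (ε : ℤ) (T : SetValuedTableau μ) (q : ℤ) (t) :
    (-q).toNat + moveRank (movesAt (T.moves ε) (2 * q - ε)) t =
      profileBefore μ (fun c => moveKey (T.boxMove ε c)) t q := by
  rw [profileBefore, movesAt_moves, moveRank_image ((T.injOn_boxMove ε).mono (Finset.filter_subset _ _))]

theorem isMoveSystem_moves {ε : ℤ} (h0 : 0 ≤ ε) (h1 : ε ≤ 1) (T : SetValuedTableau μ) :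
    IsMoveSystem (spreadCount ε μ) (T.moves ε) := by
  have hprof (t) := isProfile_profileBefore (K := fun c => moveKey (T.boxMove ε c))
    (fun c c' h h' => T.moveKey_boxMove_le ε h h') t
  have hle : ∀ c ∈ μ, ∀ c' ∈ μ, moveKey (T.boxMove ε c) < moveKey (T.boxMove ε c') →
      ¬ c' ≤ c := fun c hc c' hc' h h' => (T.moveKey_boxMove_le ε h' hc).not_gt h
  refine ⟨?_, ?_, fun t p => ?_, fun t p => ?_, ?_, ?_, fun p => ?_⟩
  · intro x hx
    obtain ⟨c, hc, rfl⟩ := Finset.mem_image.1 hx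
    exact T.nonempty c hc
  · intro x hx y hy h
    obtain ⟨c, hc, rfl⟩ := Finset.mem_image.1 hx
    obtain ⟨c', hc', rfl⟩ := Finset.mem_image.1 hy
    rw [T.injOn_moveKey_boxMove ε hc hc' h]
  · by_cases hp : Even (p + ε)
    · obtain ⟨q, rfl⟩ := eq_two_mul_sub_of_even hp
      rw [show 2 * q - ε - 2 = 2 * (q - 1) - ε by ring, initialBead_two_mul h0 h1]
      have := (hprof t q).1
      rw [← moveRank_movesAt_moves, ← moveRank_movesAt_moves, toNat_neg_sub_one] at this
      omega
    · rw [T.movesAt_moves_eq_empty hp]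
      simp [moveRank]
  · by_cases hp : Even (p + ε)
    · obtain ⟨q, rfl⟩ := eq_two_mul_sub_of_even hp
      rw [show 2 * q - ε - 2 = 2 * (q - 1) - ε by ring, initialBead_two_mul h0 h1]
      have := (hprof t q).2
      rw [← moveRank_movesAt_moves, ← moveRank_movesAt_moves, toNat_neg_sub_one] at this
      omega
    · rw [T.movesAt_moves_eq_empty hp, T.movesAt_moves_eq_empty (p := p - 2)]
      · simpa [moveRank] using initialBead_le_one p
      · rwa [show p - 2 + ε = p + ε - 2 by ring, Int.even_sub, iff_true_right even_two]
  · intro x hx y hy hlt hxy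
    obtain ⟨⟨i, j⟩, hc, rfl⟩ := Finset.mem_image.1 hx
    obtain ⟨⟨i', j'⟩, hc', rfl⟩ := Finset.mem_image.1 hy
    have := hle _ hc _ hc' hlt
    simp only [boxMove, boxContent, Prod.le_def] at hxy this ⊢
    have h1 : i ≤ i' := by omega
    have h2 : j < j' := by omega
    have hm : (i, j') ∈ μ := μ.up_left_mem h1 le_rfl hc'
    rcases h1.eq_or_lt with rfl | h1
    · exact T.row_weak _ _ _ h2 hm
    · exact (T.row_weak _ _ _ h2 hm).trans (T.nonempty _ hm)
        fun a ha b hb => (T.col_strict _ _ _ h1 hc' a ha b hb).le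
  · intro x hx y hy hlt hxy
    obtain ⟨⟨i, j⟩, hc, rfl⟩ := Finset.mem_image.1 hx
    obtain ⟨⟨i', j'⟩, hc', rfl⟩ := Finset.mem_image.1 hy
    have := hle _ hc _ hc' hlt
    simp only [boxMove, boxContent, Prod.le_def] at hxy this ⊢
    have h1 : i < i' := by omega
    have h2 : j ≤ j' := by omega
    have hm : (i, j') ∈ μ := μ.up_left_mem h1.le le_rfl hc'
    rcases h2.eq_or_lt with rfl | h2
    · exact T.col_strict _ _ _ h1 hc'
    · intro a ha b hb
      obtain ⟨d, hd⟩ := T.nonempty _ hm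
      exact (T.row_weak _ _ _ h2 hm a ha d hd).trans_lt (T.col_strict _ _ _ h1 hc' d hd b hb)
  · by_cases hp : Even (p + ε)
    · obtain ⟨q, rfl⟩ := eq_two_mul_sub_of_even hp
      rw [spreadCount_two_mul, movesAt_moves, Finset.card_image_of_injOn
        ((T.injOn_boxMove ε).mono (Finset.filter_subset _ _)), diagCount]
    · rw [T.movesAt_moves_eq_empty hp, spreadCount, if_neg hp, Finset.card_empty]

end SetValuedTableau

namespace SetValuedTableau

variable {μ : YoungDiagram}

theorem isMoveOfBox_boxMove (ε : ℤ) (T : SetValuedTableau μ) {c : ℕ × ℕ} (hc : c ∈ μ) :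
    IsMoveOfBox (fun q => movesAt (T.moves ε) (2 * q - ε)) c (T.boxMove ε c) := by
  refine ⟨mem_movesAt.2 ⟨Finset.mem_image_of_mem _ hc, rfl⟩, ?_⟩
  rw [moveRank_movesAt_moves]
  refine profileBefore_self (fun c c' h h' => T.moveKey_boxMove_le ε h h') hc fun i' j' hi hj => ?_
  refine T.moveKey_boxMove_lt ε ⟨?_, ?_⟩ ?_ hc
  · simp only [hi]; omega
  · simp only [hj]; omega
  · rw [Ne, Prod.mk.injEq]; omega

end SetValuedTableau

namespace IsMoveSystem

variable {ε : ℤ} {μ : YoungDiagram} {S : Finset Move}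

theorem injOn_movesAt {N : ℤ → ℕ} (hS : IsMoveSystem N S) (p : ℤ) :
    Set.InjOn moveKey (movesAt S p : Set Move) :=
  hS.key_inj.mono (Finset.filter_subset _ _)

theorem card_movesAt_spread (hS : IsMoveSystem (spreadCount ε μ) S) (q : ℤ) :
    (movesAt S (2 * q - ε)).card = diagCount μ q := by
  rw [hS.card_movesAt, spreadCount_two_mul]

theorem isProfile_movesAt (h0 : 0 ≤ ε) (h1 : ε ≤ 1) {N : ℤ → ℕ} (hS : IsMoveSystem N S) (t) :
    IsProfile fun q => (-q).toNat + moveRank (movesAt S (2 * q - ε)) t := by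
  intro q
  have h1' := hS.occ_nonneg t (2 * q - ε)
  have h2' := hS.occ_le_one t (2 * q - ε)
  rw [initialBead_two_mul h0 h1, show 2 * q - ε - 2 = 2 * (q - 1) - ε by ring] at h1' h2'
  simp only [toNat_neg_sub_one]
  omega

theorem exists_isMoveOfBox (hS : IsMoveSystem (spreadCount ε μ) S) {c : ℕ × ℕ} (hc : c ∈ μ) :
    ∃ x, IsMoveOfBox (fun q => movesAt S (2 * q - ε)) c x :=
  IsMoveOfBox.exists_move (hS.injOn_movesAt _) hS.card_movesAt_spread hc

end IsMoveSystem

namespace SetValuedTableau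

variable {μ : YoungDiagram}

open Classical in
/-- The set-valued tableau of a system of moves: every box is filled with the set of its move. -/
noncomputable def ofMoves {ε : ℤ} (h0 : 0 ≤ ε) (h1 : ε ≤ 1) {S : Finset Move}
    (hS : IsMoveSystem (spreadCount ε μ) S) : SetValuedTableau μ :=
  have key (c) (hc : c ∈ μ) := (hS.exists_isMoveOfBox hc).choose_spec
  have hmem (c) (hc : c ∈ μ) := (mem_movesAt.1 (key c hc).1).1
  have hlt {c c'} (hc : c ∈ μ) (hc' : c' ∈ μ) (h : c ≤ c') (hne : boxContent c ≠ boxContent c') :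
      moveKey (hS.exists_isMoveOfBox hc).choose < moveKey (hS.exists_isMoveOfBox hc').choose :=
    lt_of_le_of_ne ((key c hc).moveKey_le (hS.isProfile_movesAt h0 h1) (key c' hc') h) fun h => hne (by
      have := fst_eq_of_moveKey_eq h
      rw [(mem_movesAt.1 (key c hc).1).2, (mem_movesAt.1 (key c' hc').1).2] at this
      omega)
  { entry := fun c => if hc : c ∈ μ then (hS.exists_isMoveOfBox hc).choose.2 else ∅
    nonempty := fun c hc => by
      rw [dif_pos hc]
      exact hS.nonempty _ (hmem c hc)
    empty_outside := fun c hc => dif_neg hc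
    row_weak := fun i j₁ j₂ hj => by
      induction j₂, hj using Nat.le_induction with
      | base =>
        intro h
        have h' : (i, j₁) ∈ μ := μ.up_left_mem le_rfl (Nat.le_succ _) h
        rw [dif_pos h, dif_pos h']
        refine hS.weak _ (hmem _ h') _ (hmem _ h) (hlt h' h ⟨le_rfl, Nat.le_succ _⟩ ?_) ?_
        · simp only [boxContent]; omega
        · rw [(mem_movesAt.1 (key _ h).1).2, (mem_movesAt.1 (key _ h').1).2]
          simp only [boxContent]; push_cast; ring
      | succ j hj ih =>
        intro h
        have h' : (i, j) ∈ μ := μ.up_left_mem le_rfl (Nat.le_succ _) h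
        refine (ih h').trans ?_ ?_
        · rw [dif_pos h']
          exact hS.nonempty _ (hmem _ h')
        rw [dif_pos h, dif_pos h']
        refine hS.weak _ (hmem _ h') _ (hmem _ h) (hlt h' h ⟨le_rfl, Nat.le_succ _⟩ ?_) ?_
        · simp only [boxContent]; omega
        · rw [(mem_movesAt.1 (key _ h).1).2, (mem_movesAt.1 (key _ h').1).2]
          simp only [boxContent]; push_cast; ring
    col_strict := fun i₁ i₂ j hi => by
      induction i₂, hi using Nat.le_induction with
      | base =>
        intro h
        have h' : (i₁, j) ∈ μ := μ.up_left_mem (Nat.le_succ _) le_rfl h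
        rw [dif_pos h, dif_pos h']
        refine hS.strict _ (hmem _ h') _ (hmem _ h) (hlt h' h ⟨Nat.le_succ _, le_rfl⟩ ?_) ?_
        · simp only [boxContent]; omega
        · rw [(mem_movesAt.1 (key _ h).1).2, (mem_movesAt.1 (key _ h').1).2]
          simp only [boxContent]; push_cast; ring
      | succ i hi ih =>
        intro h
        have h' : (i, j) ∈ μ := μ.up_left_mem (Nat.le_succ _) le_rfl h
        refine (ih h').trans ?_ ?_
        · rw [dif_pos h']
          exact hS.nonempty _ (hmem _ h')
        rw [dif_pos h, dif_pos h']
        refine hS.strict _ (hmem _ h') _ (hmem _ h) (hlt h' h ⟨Nat.le_succ _, le_rfl⟩ ?_) ?_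
        · simp only [boxContent]; omega
        · rw [(mem_movesAt.1 (key _ h).1).2, (mem_movesAt.1 (key _ h').1).2]
          simp only [boxContent]; push_cast; ring }

theorem isMoveOfBox_ofMoves {ε : ℤ} (h0 : 0 ≤ ε) (h1 : ε ≤ 1) {S : Finset Move}
    (hS : IsMoveSystem (spreadCount ε μ) S) {c : ℕ × ℕ} (hc : c ∈ μ) :
    IsMoveOfBox (fun q => movesAt S (2 * q - ε)) c ((ofMoves h0 h1 hS).boxMove ε c) := by
  have h := (hS.exists_isMoveOfBox hc).choose_spec
  convert h using 1
  refine Prod.ext (mem_movesAt.1 h.1).2.symm ?_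
  exact dif_pos hc

theorem moves_ofMoves {ε : ℤ} (h0 : 0 ≤ ε) (h1 : ε ≤ 1) {S : Finset Move}
    (hS : IsMoveSystem (spreadCount ε μ) S) : (ofMoves h0 h1 hS).moves ε = S := by
  ext x
  rw [moves, Finset.mem_image]
  constructor
  · rintro ⟨c, hc, rfl⟩
    exact (mem_movesAt.1 (isMoveOfBox_ofMoves h0 h1 hS hc).1).1
  · intro hx
    have hp : Even (x.1 + ε) := by
      by_contra hp
      exact hS.fst_ne (if_neg hp) hx rfl
    obtain ⟨q, hq⟩ := eq_two_mul_sub_of_even hp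
    obtain ⟨c, -, h⟩ := IsMoveOfBox.exists_box (X := fun q => movesAt S (2 * q - ε)) (q := q)
      (mem_movesAt.2 ⟨hx, hq⟩)
    have hc : c ∈ μ := h.mem hS.card_movesAt_spread
    exact ⟨c, hc, (isMoveOfBox_ofMoves h0 h1 hS hc).eq h fun _ => hS.injOn_movesAt _⟩

/-- Set-valued tableaux of shape `μ` are the same as systems of moves on one parity class. -/
noncomputable def movesEquiv {ε : ℤ} (h0 : 0 ≤ ε) (h1 : ε ≤ 1) (μ : YoungDiagram) :
    SetValuedTableau μ ≃ {S // IsMoveSystem (spreadCount ε μ) S} :=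
  Equiv.ofBijective (fun T => ⟨T.moves ε, T.isMoveSystem_moves h0 h1⟩) <| by
    refine ⟨fun T T' h => ?_, fun S => ⟨ofMoves h0 h1 S.2, Subtype.ext (moves_ofMoves h0 h1 S.2)⟩⟩
    have h : T.moves ε = T'.moves ε := congrArg Subtype.val h
    refine SetValuedTableau.ext (funext fun c => ?_)
    by_cases hc : c ∈ μ
    · have hb := T'.isMoveOfBox_boxMove ε hc
      rw [← h] at hb
      exact congrArg Prod.snd
        ((T.isMoveOfBox_boxMove ε hc).eq hb
        fun _ => (T.isMoveSystem_moves h0 h1).injOn_movesAt _)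
    · rw [T.empty_outside c hc, T'.empty_outside c hc]

end SetValuedTableau

/-! ### Dominoes and their positions -/

namespace Domino

/-- The position of a domino: the smaller one of the contents of its two boxes. -/
def pos (F : Domino) : ℤ := if F.horizontal then F.col - F.row else F.col - F.row - 1

/-- The row of the box of smaller content. -/
def lowRow (F : Domino) : ℕ := if F.horizontal then F.row else F.row + 1

/-- The box of smaller content. -/
def lowBox (F : Domino) : ℕ × ℕ := (F.lowRow, F.col)

/-- The box of larger content. -/
def highBox (F : Domino) : ℕ × ℕ := (F.row, if F.horizontal then F.col + 1 else F.col)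

theorem mem_boxes_iff {F : Domino} {c : ℕ × ℕ} :
    c ∈ F.boxes ↔ boxContent c = F.pos ∧ c.1 = F.lowRow ∨ boxContent c = F.pos + 1 ∧ c.1 = F.row := by
  obtain ⟨i, j⟩ := c
  obtain ⟨r, s, _ | _⟩ := F <;>
    simp only [boxes, secondBox, pos, lowRow, boxContent, Finset.mem_insert, Finset.mem_singleton,
      Prod.mk.injEq, if_true, if_false, Bool.false_eq_true] <;> omega

theorem boxContent_lowBox (F : Domino) : boxContent F.lowBox = F.pos := by
  obtain ⟨r, s, _ | _⟩ := F <;> simp [lowBox, lowRow, pos, boxContent]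
  ring

theorem boxContent_highBox (F : Domino) : boxContent F.highBox = F.pos + 1 := by
  obtain ⟨r, s, _ | _⟩ := F <;> simp [highBox, pos, boxContent]
  ring

theorem lowBox_mem (F : Domino) : F.lowBox ∈ F.boxes :=
  mem_boxes_iff.2 (Or.inl ⟨F.boxContent_lowBox, rfl⟩)

theorem highBox_mem (F : Domino) : F.highBox ∈ F.boxes :=
  mem_boxes_iff.2 (Or.inr ⟨F.boxContent_highBox, rfl⟩)

theorem boxContent_of_mem {F : Domino} {c : ℕ × ℕ} (h : c ∈ F.boxes) :
    F.pos = boxContent c ∨ F.pos = boxContent c - 1 := by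
  rcases mem_boxes_iff.1 h with h | h <;> omega

theorem eq_of_mem_of_boxContent_eq {F : Domino} {c c' : ℕ × ℕ} (h : c ∈ F.boxes)
    (h' : c' ∈ F.boxes) (hc : boxContent c = boxContent c') : c = c' := by
  have h := mem_boxes_iff.1 h
  have h' := mem_boxes_iff.1 h'
  simp only [boxContent] at *
  ext <;> omega

theorem ext_of_pos {F F' : Domino} (h : F.pos = F'.pos) (h1 : F.lowRow = F'.lowRow)
    (h2 : F.row = F'.row) : F = F' := by
  obtain ⟨r, s, _ | _⟩ := F <;> obtain ⟨r', s', _ | _⟩ := F' <;>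
    simp only [pos, lowRow, if_true, if_false, Bool.false_eq_true] at * <;>
    first | omega | (rw [Domino.mk.injEq]; exact ⟨h2, by omega, rfl⟩)

theorem topLeft_le_of_mem {F : Domino} {c : ℕ × ℕ} (h : c ∈ F.boxes) :
    F.row ≤ c.1 ∧ F.col ≤ c.2 := by
  obtain ⟨i, j⟩ := c
  obtain ⟨r, s, _ | _⟩ := F <;>
    simp [boxes, secondBox] at * <;> omega

theorem topLeft_mem (F : Domino) : (F.row, F.col) ∈ F.boxes := Finset.mem_insert_self _ _

theorem onDiagonal_iff {F : Domino} {k : ℤ} : F.OnDiagonal k ↔ F.pos = 2 * k ∨ F.pos = 2 * k - 1 := by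
  constructor
  · rintro ⟨c, hc, h⟩
    have := boxContent_of_mem hc
    omega
  · rintro (h | h)
    · exact ⟨_, F.lowBox_mem, by rw [F.boxContent_lowBox, h]⟩
    · exact ⟨_, F.highBox_mem, by rw [F.boxContent_highBox, h]; ring⟩

theorem isType1_iff {F : Domino} : F.IsType1 ↔ ¬ Even F.pos := by
  constructor
  · rintro ⟨k, hk, c, hc, h⟩ ⟨m, hm⟩
    have := boxContent_of_mem hc
    have := onDiagonal_iff.1 hk
    omega
  · intro h
    obtain ⟨k, hk⟩ := Int.not_even_iff_odd.1 h
    refine ⟨k + 1, onDiagonal_iff.2 (by omega), _, F.lowBox_mem, ?_⟩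
    rw [F.boxContent_lowBox]
    omega

theorem isType2_iff {F : Domino} : F.IsType2 ↔ Even F.pos := by
  constructor
  · rintro ⟨k, hk, c, hc, h⟩
    have := boxContent_of_mem hc
    have := onDiagonal_iff.1 hk
    exact ⟨k, by omega⟩
  · rintro ⟨k, hk⟩
    refine ⟨k, onDiagonal_iff.2 (by omega), _, F.highBox_mem, ?_⟩
    rw [F.boxContent_highBox]
    omega

theorem sameType_iff {F F' : Domino} : F.SameType F' ↔ (Even F.pos ↔ Even F'.pos) := by
  rw [SameType, isType1_iff, isType1_iff, isType2_iff, isType2_iff]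
  tauto

/-- Dominoes of the same type on consecutive diagonals have positions that differ by `2`. -/
theorem pos_eq_add_two {F F' : Domino} (h : F.SameType F') {k : ℤ} (hF : F.OnDiagonal k)
    (hF' : F'.OnDiagonal (k + 1)) : F'.pos = F.pos + 2 := by
  rw [sameType_iff, Int.even_iff, Int.even_iff] at h
  rw [onDiagonal_iff] at hF hF'
  omega

theorem exists_onDiagonal {F F' : Domino} (h : F'.pos = F.pos + 2) :
    F.SameType F' ∧ ∃ k, F.OnDiagonal k ∧ F'.OnDiagonal (k + 1) := by
  rw [sameType_iff, Int.even_iff, Int.even_iff]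
  refine ⟨by omega, (F.pos + 1) / 2, ?_⟩
  rw [onDiagonal_iff, onDiagonal_iff]
  omega

theorem SameType.symm {F F' : Domino} (h : F.SameType F') : F'.SameType F :=
  sameType_iff.2 (sameType_iff.1 h).symm

end Domino

theorem DominoPaving.exists_mem {lam : YoungDiagram} (P : DominoPaving lam) {c : ℕ × ℕ}
    (hc : c ∈ lam) : ∃ F ∈ P.dominoes, c ∈ F.boxes := by
  have : c ∈ P.dominoes.biUnion Domino.boxes := P.cover ▸ (YoungDiagram.mem_cells _).2 hc
  simpa using this

theorem DominoPaving.mem_of_mem_boxes {lam : YoungDiagram} (P : DominoPaving lam) {F : Domino}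
    (hF : F ∈ P.dominoes) {c : ℕ × ℕ} (hc : c ∈ F.boxes) : c ∈ lam :=
  (YoungDiagram.mem_cells _).1 (P.cover ▸ Finset.mem_biUnion.2 ⟨F, hF, hc⟩)

theorem DominoPaving.eq_of_mem {lam : YoungDiagram} (P : DominoPaving lam) {F F' : Domino}
    (hF : F ∈ P.dominoes) (hF' : F' ∈ P.dominoes) {c : ℕ × ℕ} (hc : c ∈ F.boxes)
    (hc' : c ∈ F'.boxes) : F = F' := by
  by_contra h
  exact Finset.disjoint_left.1 (P.disjoint F hF F' hF' h) hc hc'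

open Classical in
/-- The domino of a paving that covers the box `c` of its shape (an arbitrary domino if `c` is not
a box of the shape). -/
noncomputable def DominoPaving.dominoAt {lam : YoungDiagram} (P : DominoPaving lam) (c : ℕ × ℕ) :
    Domino := if h : c ∈ lam then (P.exists_mem h).choose else ⟨0, 0, true⟩

theorem DominoPaving.dominoAt_spec {lam : YoungDiagram} (P : DominoPaving lam) {c : ℕ × ℕ}
    (hc : c ∈ lam) : P.dominoAt c ∈ P.dominoes ∧ c ∈ (P.dominoAt c).boxes := by
  rw [DominoPaving.dominoAt, dif_pos hc]
  exact (P.exists_mem hc).choose_spec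

theorem DominoPaving.dominoAt_eq {lam : YoungDiagram} (P : DominoPaving lam) {F : Domino}
    (hF : F ∈ P.dominoes) {c : ℕ × ℕ} (hc : c ∈ F.boxes) : P.dominoAt c = F :=
  have h := P.dominoAt_spec (P.mem_of_mem_boxes hF hc)
  P.eq_of_mem h.1 hF h.2 hc

/-! ### Domino tableaux as systems of moves -/

/-- The moves of dominoes that have a box of content `q`. -/
def movesNear (S : Finset Move) (q : ℤ) : Finset Move :=
  S.filter fun x => x.1 = q ∨ x.1 = q - 1

theorem moveRank_movesNear (S : Finset Move) (q : ℤ) (t) :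
    moveRank (movesNear S q) t = moveRank (movesAt S q) t + moveRank (movesAt S (q - 1)) t := by
  rw [moveRank, moveRank, moveRank, ← Finset.card_union_of_disjoint]
  · congr 1
    ext x
    simp only [movesNear, movesAt, Finset.mem_filter, Finset.mem_union]
    tauto
  · rw [Finset.disjoint_left]
    intro x hx hx'
    simp only [movesAt, Finset.mem_filter] at hx hx'
    omega

theorem card_movesNear (S : Finset Move) (q : ℤ) :
    (movesNear S q).card = (movesAt S q).card + (movesAt S (q - 1)).card := by
  rw [← Finset.card_union_of_disjoint]
  · congr 1
    ext x
    simp only [movesNear, movesAt, Finset.mem_filter, Finset.mem_union]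
    tauto
  · rw [Finset.disjoint_left]
    intro x hx hx'
    simp only [movesAt, Finset.mem_filter] at hx hx'
    omega

theorem diagCount_eq_zero {μ : YoungDiagram} {p : ℤ} (hp : p ≤ -μ.colLen 0) :
    diagCount μ p = 0 := by
  rw [diagCount, Finset.card_eq_zero, Finset.filter_eq_empty_iff]
  rintro ⟨i, j⟩ hc h
  have : i < μ.colLen 0 := YoungDiagram.mem_iff_lt_colLen.1
    (μ.up_left_mem le_rfl (Nat.zero_le j) ((YoungDiagram.mem_cells _).1 hc))
  simp only [boxContent] at h
  omega

/-- The numbers of dominoes at all positions are determined by the shape. -/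
theorem eq_of_add_eq_diagCount {μ : YoungDiagram} {N N' : ℤ → ℕ}
    (h : ∀ p, N p + N (p - 1) = diagCount μ p) (h' : ∀ p, N' p + N' (p - 1) = diagCount μ p) :
    N = N' := by
  have hb (p : ℤ) (hp : p ≤ -μ.colLen 0) : N p = N' p := by
    have := h p
    have := h' p
    rw [diagCount_eq_zero hp] at *
    omega
  funext p
  rcases le_total p (-μ.colLen 0) with hp | hp
  · exact hb p hp
  · induction p, hp using Int.leInduction with
    | base => exact hb _ le_rfl
    | succ p hp ih =>
      have h1 := h (p + 1)
      have h2 := h' (p + 1)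
      rw [add_sub_cancel_right] at h1 h2
      omega

namespace SetValuedDominoTableau

variable {lam : YoungDiagram}

/-- The move of a domino. -/
def dominoMove (T : SetValuedDominoTableau lam) (F : Domino) : Move := (F.pos, T.entry F)

/-- The system of moves of a set-valued domino tableau. -/
def moves (T : SetValuedDominoTableau lam) : Finset Move := T.paving.dominoes.image T.dominoMove

theorem min_lt_of_column (T : SetValuedDominoTableau lam) {F F' : Domino}
    (hF : F ∈ T.paving.dominoes) (hF' : F' ∈ T.paving.dominoes) (hne : F ≠ F') {i i' j : ℕ}
    (h : (i, j) ∈ F.boxes) (h' : (i', j) ∈ F'.boxes) (hi : i < i') :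
    (T.entry F).min < (T.entry F').min :=
  (T.min_isDominoTableau F hF F' hF' hne).2 i i' j h h' hi

theorem min_le_of_row (T : SetValuedDominoTableau lam) {F F' : Domino}
    (hF : F ∈ T.paving.dominoes) (hF' : F' ∈ T.paving.dominoes) (hne : F ≠ F') {i j j' : ℕ}
    (h : (i, j) ∈ F.boxes) (h' : (i, j') ∈ F'.boxes) (hj : j < j') :
    (T.entry F).min ≤ (T.entry F').min :=
  (T.min_isDominoTableau F hF F' hF' hne).1 i j j' h h' hj

/-- Along a row, keys increase strictly. This is not immediate when the two dominoes have equal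
positions. Then they are vertical in adjacent columns, the left one reaching up one row further, and
a domino of the upper row that lies above the right one shows that the minima differ. -/
theorem moveKey_lt_of_row (T : SetValuedDominoTableau lam) {F F' : Domino}
    (hF : F ∈ T.paving.dominoes) (hF' : F' ∈ T.paving.dominoes) (hne : F ≠ F') {i j j' : ℕ}
    (h : (i, j) ∈ F.boxes) (h' : (i, j') ∈ F'.boxes) (hj : j < j') :
    moveKey (T.dominoMove F) < moveKey (T.dominoMove F') := by
  rw [moveKey_lt_iff]
  rcases (T.min_le_of_row hF hF' hne h h' hj).lt_or_eq with hlt | heq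
  · exact Or.inl hlt
  by_cases hp : F.pos < F'.pos
  · exact Or.inr ⟨heq, hp⟩
  refine absurd heq (ne_of_lt ?_)
  have h1 := Domino.boxContent_of_mem h
  have h2 := Domino.boxContent_of_mem h'
  have hc : boxContent (i, j) = F.pos := by simp only [boxContent] at *; omega
  have hj' : j' = j + 1 := by simp only [boxContent] at *; omega
  have hpos : F'.pos = F.pos := by simp only [boxContent] at *; omega
  subst hj'
  have hh := F.highBox_mem
  have hhc := F.boxContent_highBox
  have hrow : i = F.row + 1 ∧ F.highBox = (F.row, j) := by
    have hne' : F.highBox ≠ (i, j + 1) := fun h => hne (T.paving.eq_of_mem hF hF' (h ▸ hh) h')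
    have h3 := Domino.mem_boxes_iff.1 h
    generalize hB : F.highBox = B at *
    obtain ⟨a, b⟩ := B
    have ha : F.row = a := congrArg Prod.fst hB
    rw [Ne, Prod.mk.injEq] at hne'
    rw [Prod.mk.injEq]
    simp only [Domino.lowRow, boxContent] at *
    split_ifs at * <;> omega
  obtain ⟨rfl, hB⟩ := hrow
  rw [hB] at hh hhc
  have hm : (F.row, j + 1) ∈ lam :=
    lam.up_left_mem (Nat.le_succ _) le_rfl (T.paving.mem_of_mem_boxes hF' h')
  obtain ⟨hG, hG'⟩ := T.paving.dominoAt_spec hm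
  have hGc := Domino.boxContent_of_mem hG'
  refine (T.min_le_of_row hF hG ?_ hh hG' (Nat.lt_succ_self _)).trans_lt
    (T.min_lt_of_column hG hF' ?_ hG' h' (Nat.lt_succ_self _))
  · intro h
    rw [← h] at hGc
    simp only [boxContent] at *
    omega
  · intro h
    rw [h] at hGc
    simp only [boxContent] at *
    omega

/-- Keys increase weakly along the order of boxes. -/
theorem moveKey_le_of_le (T : SetValuedDominoTableau lam) {F F' : Domino}
    (hF : F ∈ T.paving.dominoes) (hF' : F' ∈ T.paving.dominoes) {c c' : ℕ × ℕ}
    (h : c ∈ F.boxes) (h' : c' ∈ F'.boxes) (hc : c ≤ c') :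
    moveKey (T.dominoMove F) ≤ moveKey (T.dominoMove F') := by
  obtain ⟨i, j⟩ := c
  obtain ⟨i', j'⟩ := c'
  obtain ⟨hi, hj⟩ : i ≤ i' ∧ j ≤ j' := hc
  have hm : (i, j') ∈ lam := lam.up_left_mem hi le_rfl (T.paving.mem_of_mem_boxes hF' h')
  obtain ⟨hG, hG'⟩ := T.paving.dominoAt_spec hm
  refine le_trans (b := moveKey (T.dominoMove (T.paving.dominoAt (i, j')))) ?_ ?_
  · by_cases hne : F = T.paving.dominoAt (i, j')
    · rw [← hne]
    · rcases hj.eq_or_lt with rfl | hj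
      · exact absurd (T.paving.eq_of_mem hF hG h hG') hne
      · exact (T.moveKey_lt_of_row hF hG hne h hG' hj).le
  · by_cases hne : T.paving.dominoAt (i, j') = F'
    · rw [hne]
    · rcases hi.eq_or_lt with rfl | hi
      · exact absurd (T.paving.eq_of_mem hG hF' hG' h') hne
      · exact le_of_lt (moveKey_lt_iff.2 (Or.inl (T.min_lt_of_column hG hF' hne hG' h' hi)))

theorem moveKey_lt_of_le (T : SetValuedDominoTableau lam) {F F' : Domino}
    (hF : F ∈ T.paving.dominoes) (hF' : F' ∈ T.paving.dominoes) (hne : F ≠ F') {c c' : ℕ × ℕ}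
    (h : c ∈ F.boxes) (h' : c' ∈ F'.boxes) (hc : c ≤ c') :
    moveKey (T.dominoMove F) < moveKey (T.dominoMove F') := by
  obtain ⟨i, j⟩ := c
  obtain ⟨i', j'⟩ := c'
  obtain ⟨hi, hj⟩ : i ≤ i' ∧ j ≤ j' := hc
  have hm : (i, j') ∈ lam := lam.up_left_mem hi le_rfl (T.paving.mem_of_mem_boxes hF' h')
  obtain ⟨hG, hG'⟩ := T.paving.dominoAt_spec hm
  have h1 := T.moveKey_le_of_le hF hG h hG' (Prod.mk_le_mk.2 ⟨le_rfl, hj⟩)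
  rcases hi.eq_or_lt with rfl | hi
  · rcases hj.eq_or_lt with rfl | hj
    · exact absurd (T.paving.eq_of_mem hF hF' h h') hne
    · exact T.moveKey_lt_of_row hF hF' hne h h' hj
  · by_cases hne' : T.paving.dominoAt (i, j') = F'
    · rw [hne'] at hG'
      rcases hj.eq_or_lt with rfl | hj
      · exact absurd (T.paving.eq_of_mem hF hF' h hG') hne
      · exact T.moveKey_lt_of_row hF hF' hne h hG' hj
    · exact h1.trans_lt (moveKey_lt_iff.2 (Or.inl (T.min_lt_of_column hG hF' hne' hG' h' hi)))

theorem injOn_moveKey_dominoMove (T : SetValuedDominoTableau lam) :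
    Set.InjOn (fun F => moveKey (T.dominoMove F)) (T.paving.dominoes : Set Domino) := by
  intro F hF F' hF' h
  have hp : F.pos = F'.pos := fst_eq_of_moveKey_eq h
  by_contra hne
  rcases le_total_of_boxContent_eq (c := F.lowBox) (c' := F'.lowBox)
    (by rw [F.boxContent_lowBox, F'.boxContent_lowBox, hp]) with h' | h'
  · exact (T.moveKey_lt_of_le hF hF' hne F.lowBox_mem F'.lowBox_mem h').ne h
  · exact (T.moveKey_lt_of_le hF' hF (Ne.symm hne) F'.lowBox_mem F.lowBox_mem h').ne h.symm

theorem injOn_dominoMove (T : SetValuedDominoTableau lam) :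
    Set.InjOn T.dominoMove (T.paving.dominoes : Set Domino) := fun _ hF _ hF' h =>
  T.injOn_moveKey_dominoMove hF hF' (congrArg moveKey h)

/-- The key of the domino that covers a box. -/
noncomputable def boxKey (T : SetValuedDominoTableau lam) (c : ℕ × ℕ) : WithTop ℕ+ ×ₗ ℤ :=
  moveKey (T.dominoMove (T.paving.dominoAt c))

theorem boxKey_eq (T : SetValuedDominoTableau lam) {F : Domino} (hF : F ∈ T.paving.dominoes)
    {c : ℕ × ℕ} (hc : c ∈ F.boxes) : T.boxKey c = moveKey (T.dominoMove F) := by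
  rw [boxKey, T.paving.dominoAt_eq hF hc]

theorem boxKey_le (T : SetValuedDominoTableau lam) (c c' : ℕ × ℕ) (h : c ≤ c') (hc' : c' ∈ lam) :
    T.boxKey c ≤ T.boxKey c' := by
  have hc : c ∈ lam := lam.isLowerSet h hc'
  obtain ⟨hF, hc⟩ := T.paving.dominoAt_spec hc
  obtain ⟨hF', hc'⟩ := T.paving.dominoAt_spec hc'
  exact T.moveKey_le_of_le hF hF' hc hc' h

theorem moveRank_movesNear_moves (T : SetValuedDominoTableau lam) (q : ℤ) (t) :
    (-q).toNat + moveRank (movesNear T.moves q) t = profileBefore lam T.boxKey t q := by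
  rw [profileBefore, movesNear, moves, Finset.filter_image,
    moveRank_image (T.injOn_dominoMove.mono (Finset.filter_subset _ _))]
  congr 1
  symm
  refine Finset.card_bij (fun c _ => T.paving.dominoAt c) (fun c hc => ?_)
    (fun c hc c' hc' h => ?_) (fun F hF => ?_)
  · simp only [Finset.mem_filter] at hc ⊢
    obtain ⟨⟨hc, rfl⟩, ht⟩ := hc
    obtain ⟨hF, hc⟩ := T.paving.dominoAt_spec ((YoungDiagram.mem_cells _).1 hc)
    exact ⟨⟨hF, Domino.boxContent_of_mem hc⟩, ht⟩
  · simp only [Finset.mem_filter] at hc hc'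
    obtain ⟨hF, h1⟩ := T.paving.dominoAt_spec ((YoungDiagram.mem_cells _).1 hc.1.1)
    obtain ⟨hF', h2⟩ := T.paving.dominoAt_spec ((YoungDiagram.mem_cells _).1 hc'.1.1)
    rw [← h] at h2
    exact Domino.eq_of_mem_of_boxContent_eq h1 h2 (hc.1.2.trans hc'.1.2.symm)
  · simp only [Finset.mem_filter] at hF
    obtain ⟨⟨hF, hp⟩, ht⟩ := hF
    have key : ∃ c ∈ F.boxes, boxContent c = q := by
      rcases hp with hp | hp
      · exact ⟨_, F.lowBox_mem, F.boxContent_lowBox.trans hp⟩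
      · refine ⟨_, F.highBox_mem, F.boxContent_highBox.trans ?_⟩
        simp only [dominoMove] at hp
        omega
    obtain ⟨c, hc, hq⟩ := key
    refine ⟨c, ?_, T.paving.dominoAt_eq hF hc⟩
    simp only [Finset.mem_filter, T.boxKey_eq hF hc]
    exact ⟨⟨(YoungDiagram.mem_cells _).2 (T.paving.mem_of_mem_boxes hF hc), hq⟩, ht⟩

theorem isMoveOfBox_dominoMove (T : SetValuedDominoTableau lam) {F : Domino}
    (hF : F ∈ T.paving.dominoes) {c : ℕ × ℕ} (hc : c ∈ F.boxes) :
    IsMoveOfBox (movesNear T.moves) c (T.dominoMove F) := by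
  refine ⟨Finset.mem_filter.2 ⟨Finset.mem_image_of_mem _ hF, Domino.boxContent_of_mem hc⟩, ?_⟩
  rw [moveRank_movesNear_moves, ← T.boxKey_eq hF hc]
  have hm := T.paving.mem_of_mem_boxes hF hc
  obtain ⟨i, j⟩ := c
  refine profileBefore_self T.boxKey_le hm fun i' j' hi hj => ?_
  subst hi hj
  have hm' : (i', j') ∈ lam := lam.up_left_mem (Nat.le_succ _) (Nat.le_succ _) hm
  obtain ⟨hG, hG'⟩ := T.paving.dominoAt_spec hm'
  rw [T.boxKey_eq hF hc]
  refine T.moveKey_lt_of_le hG hF (fun h => ?_) hG' hc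
    (Prod.mk_le_mk.2 ⟨Nat.le_succ _, Nat.le_succ _⟩)
  rw [h] at hG'
  have := Domino.eq_of_mem_of_boxContent_eq hG' hc (by simp [boxContent])
  simp at this

theorem nonempty_of_mem_moves (T : SetValuedDominoTableau lam) {x : Move} (hx : x ∈ T.moves) :
    x.2.Nonempty := by
  obtain ⟨F, hF, rfl⟩ := Finset.mem_image.1 hx
  exact T.nonempty F hF

theorem card_movesNear_moves (T : SetValuedDominoTableau lam) (q : ℤ) :
    (movesNear T.moves q).card = diagCount lam q := by
  have h := T.moveRank_movesNear_moves q endTime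
  rw [moveRank_endTime (X := movesNear T.moves q) fun x hx =>
      T.nonempty_of_mem_moves (Finset.filter_subset _ _ hx),
    profileBefore, Finset.filter_true_of_mem] at h
  · exact Nat.add_left_cancel h
  · intro c hc
    exact moveKey_lt_endTime (T.nonempty _ (T.paving.dominoAt_spec
      ((YoungDiagram.mem_cells _).1 (Finset.mem_of_mem_filter _ hc))).1)

theorem isMoveSystem_moves {N : ℤ → ℕ} (hN : ∀ p, N p + N (p - 1) = diagCount lam p)
    (T : SetValuedDominoTableau lam) : IsMoveSystem N T.moves := by
  have hprof (t) (p) := isProfile_profileBefore T.boxKey_le t p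
  simp only [← moveRank_movesNear_moves, moveRank_movesNear, toNat_neg_sub_one] at hprof
  have hcard : (fun p => (movesAt T.moves p).card) = N :=
    eq_of_add_eq_diagCount (fun p => by rw [← T.card_movesNear_moves, card_movesNear]) hN
  refine ⟨fun x => T.nonempty_of_mem_moves, ?_, fun t p => ?_, fun t p => ?_, ?_, ?_,
    fun p => congrFun hcard p⟩
  · intro x hx y hy h
    obtain ⟨F, hF, rfl⟩ := Finset.mem_image.1 hx
    obtain ⟨F', hF', rfl⟩ := Finset.mem_image.1 hy
    rw [T.injOn_moveKey_dominoMove hF hF' h]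
  · have := (hprof t p).1
    rw [show p - 1 - 1 = p - 2 by ring] at this
    omega
  · have := (hprof t p).2
    rw [show p - 1 - 1 = p - 2 by ring] at this
    omega
  · intro x hx y hy hlt hxy
    obtain ⟨F, hF, rfl⟩ := Finset.mem_image.1 hx
    obtain ⟨F', hF', rfl⟩ := Finset.mem_image.1 hy
    obtain ⟨hs, k, h1, h2⟩ := Domino.exists_onDiagonal hxy
    refine T.weak F hF F' hF' hs ?_ k h1 h2
    -- The boxes of `F` and `F'` of adjacent contents are comparable; the keys tell which is larger.
    have hc : ¬ F'.lowBox ≤ F.highBox := fun h =>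
      (T.moveKey_le_of_le hF' hF F'.lowBox_mem F.highBox_mem h).not_gt hlt
    have e1 := F.boxContent_highBox
    have e2 := F'.boxContent_lowBox
    have e3 := Domino.topLeft_le_of_mem F.highBox_mem
    simp only [dominoMove] at hxy
    refine ⟨_, F'.lowBox_mem, ?_⟩
    simp only [boxContent, Prod.le_def] at *
    omega
  · intro x hx y hy hlt hxy
    obtain ⟨F, hF, rfl⟩ := Finset.mem_image.1 hx
    obtain ⟨F', hF', rfl⟩ := Finset.mem_image.1 hy
    simp only [dominoMove] at hxy
    obtain ⟨hs, k, h1, h2⟩ := Domino.exists_onDiagonal (F := F') (F' := F) (by omega)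
    refine T.strict F hF F' hF' hs.symm ?_ k h2 h1
    have hc : ¬ F'.highBox ≤ F.lowBox := fun h =>
      (T.moveKey_le_of_le hF' hF F'.highBox_mem F.lowBox_mem h).not_gt hlt
    have e1 := F'.boxContent_highBox
    have e2 := F.boxContent_lowBox
    have e3 := Domino.topLeft_le_of_mem F.lowBox_mem
    refine ⟨_, F'.highBox_mem, ?_⟩
    simp only [boxContent, Prod.le_def] at *
    omega

end SetValuedDominoTableau

/-- The first row without a box of content `q` just before the move `x` of the system `S`. -/
def rowBefore (S : Finset Move) (x : Move) (q : ℤ) : ℕ :=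
  (-q).toNat + moveRank (movesNear S q) (moveKey x)

/-- The domino of a move `x`: it consists of the next free boxes of contents `x.1` and `x.1 + 1`,
which lie in the same row or in consecutive rows. -/
def dominoOf (S : Finset Move) (x : Move) : Domino :=
  ⟨rowBefore S x (x.1 + 1), (rowBefore S x x.1 + x.1).toNat,
    decide (rowBefore S x x.1 = rowBefore S x (x.1 + 1))⟩

open Classical in
/-- The set of the move that belongs to the domino `F`, and `∅` if there is none. -/
noncomputable def dominoEntry (S : Finset Move) (F : Domino) : Finset ℕ+ :=
  if h : ∃ x ∈ S, dominoOf S x = F then h.choose.2 else ∅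

namespace IsMoveSystem

variable {N : ℤ → ℕ} {S : Finset Move}

theorem isProfile_movesNear (hS : IsMoveSystem N S) (t) :
    IsProfile fun q => (-q).toNat + moveRank (movesNear S q) t := by
  intro q
  have h1 := hS.occ_nonneg t q
  have h2 := hS.occ_le_one t q
  simp only [toNat_neg_sub_one, moveRank_movesNear, show q - 1 - 1 = q - 2 by ring]
  omega

theorem injOn_movesNear (hS : IsMoveSystem N S) (q : ℤ) :
    Set.InjOn moveKey (movesNear S q : Set Move) :=
  hS.key_inj.mono (Finset.filter_subset _ _)

theorem pos_dominoOf (hS : IsMoveSystem N S) (x : Move) : (dominoOf S x).pos = x.1 := by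
  have h := hS.isProfile_movesNear (moveKey x) (x.1 + 1)
  simp only [add_sub_cancel_right] at h
  by_cases e : rowBefore S x x.1 = rowBefore S x (x.1 + 1) <;>
  · simp only [Domino.pos, dominoOf, e, decide_true, decide_false, if_true, Bool.false_eq_true,
      if_false]
    simp only [rowBefore] at *
    omega

theorem lowRow_dominoOf (hS : IsMoveSystem N S) (x : Move) :
    (dominoOf S x).lowRow = rowBefore S x x.1 := by
  have h := hS.isProfile_movesNear (moveKey x) (x.1 + 1)
  simp only [add_sub_cancel_right] at h
  by_cases e : rowBefore S x x.1 = rowBefore S x (x.1 + 1)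
  · simp only [Domino.lowRow, dominoOf, e, decide_true, if_true]
  · simp only [Domino.lowRow, dominoOf, e, decide_false, Bool.false_eq_true, if_false]
    simp only [rowBefore] at *
    omega

theorem mem_boxes_dominoOf_iff (hS : IsMoveSystem N S) {x : Move} (hx : x ∈ S) {c : ℕ × ℕ} :
    c ∈ (dominoOf S x).boxes ↔ IsMoveOfBox (movesNear S) c x := by
  rw [Domino.mem_boxes_iff, hS.pos_dominoOf, hS.lowRow_dominoOf, IsMoveOfBox, movesNear,
    Finset.mem_filter, ← movesNear]
  constructor
  · rintro (⟨h1, h2⟩ | ⟨h1, h2⟩)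
    · exact ⟨⟨hx, Or.inl h1.symm⟩, by rw [h1]; exact h2.symm⟩
    · exact ⟨⟨hx, Or.inr (by omega)⟩, by rw [h1]; exact h2.symm⟩
  · rintro ⟨⟨-, h | h⟩, h2⟩
    · exact Or.inl ⟨h.symm, by rw [h]; exact h2.symm⟩
    · refine Or.inr ⟨by omega, ?_⟩
      rw [← h2, show boxContent c = x.1 + 1 by omega]
      rfl

theorem isMoveOfBox_of_mem (hS : IsMoveSystem N S) {x : Move} (hx : x ∈ S) {c : ℕ × ℕ}
    (hc : c ∈ (dominoOf S x).boxes) : IsMoveOfBox (movesNear S) c x :=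
  (hS.mem_boxes_dominoOf_iff hx).1 hc

theorem eq_of_mem_boxes (hS : IsMoveSystem N S) {x y : Move} (hx : x ∈ S) (hy : y ∈ S)
    {c : ℕ × ℕ} (hc : c ∈ (dominoOf S x).boxes) (hc' : c ∈ (dominoOf S y).boxes) : x = y :=
  (hS.isMoveOfBox_of_mem hx hc).eq (hS.isMoveOfBox_of_mem hy hc') hS.injOn_movesNear

theorem injOn_dominoOf (hS : IsMoveSystem N S) : Set.InjOn (dominoOf S) (S : Set Move) := by
  intro x hx y hy h
  exact hS.eq_of_mem_boxes hx hy (Domino.topLeft_mem _) (h ▸ Domino.topLeft_mem _)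

theorem dominoEntry_dominoOf (hS : IsMoveSystem N S) {x : Move} (hx : x ∈ S) :
    dominoEntry S (dominoOf S x) = x.2 := by
  have h : ∃ y ∈ S, dominoOf S y = dominoOf S x := ⟨x, hx, rfl⟩
  rw [dominoEntry, dif_pos h, hS.injOn_dominoOf h.choose_spec.1 hx h.choose_spec.2]

theorem moveKey_le_of_le (hS : IsMoveSystem N S) {x y : Move} (hx : x ∈ S) (hy : y ∈ S)
    {c c' : ℕ × ℕ} (hc : c ∈ (dominoOf S x).boxes) (hc' : c' ∈ (dominoOf S y).boxes)
    (h : c ≤ c') : moveKey x ≤ moveKey y :=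
  (hS.isMoveOfBox_of_mem hx hc).moveKey_le hS.isProfile_movesNear (hS.isMoveOfBox_of_mem hy hc') h

theorem moveKey_lt_of_le (hS : IsMoveSystem N S) {x y : Move} (hx : x ∈ S) (hy : y ∈ S)
    {c c' : ℕ × ℕ} (hc : c ∈ (dominoOf S x).boxes) (hc' : c' ∈ (dominoOf S y).boxes)
    (h : c ≤ c') (hne : x ≠ y) : moveKey x < moveKey y :=
  lt_of_le_of_ne (hS.moveKey_le_of_le hx hy hc hc' h) fun h => hne (hS.key_inj hx hy h)

variable {lam : YoungDiagram}

/-- The dominoes of a system of moves pave the diagram with the right diagonal lengths. -/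
def paving (hS : IsMoveSystem N S) (hN : ∀ p, N p + N (p - 1) = diagCount lam p) :
    DominoPaving lam where
  dominoes := S.image (dominoOf S)
  disjoint := by
    intro F hF F' hF' hne
    obtain ⟨x, hx, rfl⟩ := Finset.mem_image.1 hF
    obtain ⟨y, hy, rfl⟩ := Finset.mem_image.1 hF'
    rw [Finset.disjoint_left]
    exact fun c hc hc' => hne (congrArg _ (hS.eq_of_mem_boxes hx hy hc hc'))
  cover := by
    have hcard (q) : (movesNear S q).card = diagCount lam q := by
      rw [card_movesNear, hS.card_movesAt, hS.card_movesAt, hN]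
    ext c
    rw [Finset.mem_biUnion, YoungDiagram.mem_cells]
    constructor
    · rintro ⟨F, hF, hc⟩
      obtain ⟨x, hx, rfl⟩ := Finset.mem_image.1 hF
      exact (hS.isMoveOfBox_of_mem hx hc).mem hcard
    · intro hc
      obtain ⟨x, h⟩ := IsMoveOfBox.exists_move (hS.injOn_movesNear _) hcard hc
      have hx : x ∈ S := Finset.filter_subset _ _ h.1
      exact ⟨_, Finset.mem_image_of_mem _ hx, (hS.mem_boxes_dominoOf_iff hx).2 h⟩

end IsMoveSystem

namespace SetValuedDominoTableau

variable {lam : YoungDiagram} {N : ℤ → ℕ} {S : Finset Move}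

/-- The set-valued domino tableau of a system of moves. -/
noncomputable def ofMoves (hN : ∀ p, N p + N (p - 1) = diagCount lam p) (hS : IsMoveSystem N S) :
    SetValuedDominoTableau lam where
  paving := hS.paving hN
  entry := dominoEntry S
  nonempty := fun F hF => by
    obtain ⟨x, hx, rfl⟩ := Finset.mem_image.1 hF
    rw [hS.dominoEntry_dominoOf hx]
    exact hS.nonempty x hx
  empty_outside := fun F hF => dif_neg fun ⟨x, hx, h⟩ => hF (Finset.mem_image.2 ⟨x, hx, h⟩)
  min_isDominoTableau := fun F hF F' hF' hne => by
    obtain ⟨x, hx, rfl⟩ := Finset.mem_image.1 hF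
    obtain ⟨y, hy, rfl⟩ := Finset.mem_image.1 hF'
    have hxy : x ≠ y := fun h => hne (congrArg _ h)
    simp only [hS.dominoEntry_dominoOf hx, hS.dominoEntry_dominoOf hy]
    refine ⟨fun i j₁ j₂ h₁ h₂ hj => ?_, fun i₁ i₂ j h₁ h₂ hi => ?_⟩
    · rcases moveKey_lt_iff.1 (hS.moveKey_lt_of_le hx hy h₁ h₂ ⟨le_rfl, hj.le⟩ hxy) with h | h
      · exact h.le
      · exact h.1.le
    · rcases moveKey_lt_iff.1 (hS.moveKey_lt_of_le hx hy h₁ h₂ ⟨hi.le, le_rfl⟩ hxy) with h | h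
      · exact h
      · -- Down a column, contents decrease, so the positions cannot increase.
        exfalso
        have e₁ := Domino.boxContent_of_mem h₁
        have e₂ := Domino.boxContent_of_mem h₂
        rw [hS.pos_dominoOf] at e₁ e₂
        simp only [boxContent] at e₁ e₂
        omega
  weak := fun F hF F' hF' hs hse k h₁ h₂ => by
    have hp := Domino.pos_eq_add_two hs h₁ h₂
    obtain ⟨x, hx, rfl⟩ := Finset.mem_image.1 hF
    obtain ⟨y, hy, rfl⟩ := Finset.mem_image.1 hF'
    obtain ⟨c, hc, hle⟩ := hse
    rw [hS.pos_dominoOf, hS.pos_dominoOf] at hp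
    rw [hS.dominoEntry_dominoOf hx, hS.dominoEntry_dominoOf hy]
    refine hS.weak x hx y hy (hS.moveKey_lt_of_le hx hy (Domino.topLeft_mem _) hc hle ?_) hp
    rintro rfl
    omega
  strict := fun F hF F' hF' hs hse k h₁ h₂ => by
    have hp := Domino.pos_eq_add_two hs.symm h₂ h₁
    obtain ⟨x, hx, rfl⟩ := Finset.mem_image.1 hF
    obtain ⟨y, hy, rfl⟩ := Finset.mem_image.1 hF'
    obtain ⟨c, hc, hle⟩ := hse
    rw [hS.pos_dominoOf, hS.pos_dominoOf] at hp
    rw [hS.dominoEntry_dominoOf hx, hS.dominoEntry_dominoOf hy]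
    refine hS.strict x hx y hy (hS.moveKey_lt_of_le hx hy (Domino.topLeft_mem _) hc hle ?_)
      (by omega)
    rintro rfl
    omega

theorem moves_ofMoves (hN : ∀ p, N p + N (p - 1) = diagCount lam p) (hS : IsMoveSystem N S) :
    (ofMoves hN hS).moves = S := by
  have h (x) (hx : x ∈ S) : (ofMoves hN hS).dominoMove (dominoOf S x) = x :=
    Prod.ext (hS.pos_dominoOf x) (hS.dominoEntry_dominoOf hx)
  change (S.image (dominoOf S)).image _ = S
  rw [Finset.image_image]
  refine (Finset.image_congr fun x hx => ?_).trans Finset.image_id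
  exact h x hx

theorem dominoOf_dominoMove (T : SetValuedDominoTableau lam) {F : Domino}
    (hF : F ∈ T.paving.dominoes) : dominoOf T.moves (T.dominoMove F) = F := by
  have hS : IsMoveSystem _ T.moves := T.isMoveSystem_moves (N := fun p => (movesAt T.moves p).card)
    fun p => by rw [← T.card_movesNear_moves, card_movesNear]
  have hx : T.dominoMove F ∈ T.moves := Finset.mem_image_of_mem _ hF
  have h1 := (T.isMoveOfBox_dominoMove hF F.lowBox_mem).2
  have h2 := (T.isMoveOfBox_dominoMove hF F.highBox_mem).2
  rw [F.boxContent_lowBox] at h1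
  rw [F.boxContent_highBox] at h2
  exact Domino.ext_of_pos (hS.pos_dominoOf _) ((hS.lowRow_dominoOf _).trans h1) h2

theorem dominoes_eq (T : SetValuedDominoTableau lam) :
    T.paving.dominoes = T.moves.image (dominoOf T.moves) := by
  conv_rhs => enter [2]; rw [moves]
  rw [Finset.image_image]
  refine (Finset.image_id.symm.trans (Finset.image_congr fun F hF => ?_))
  exact (T.dominoOf_dominoMove hF).symm

theorem entry_dominoOf (T : SetValuedDominoTableau lam) {x : Move} (hx : x ∈ T.moves) :
    T.entry (dominoOf T.moves x) = x.2 := by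
  obtain ⟨F, hF, rfl⟩ := Finset.mem_image.1 hx
  rw [T.dominoOf_dominoMove hF]
  rfl

/-- Set-valued domino tableaux of shape `lam` are the same as systems of moves whose numbers of
moves at all positions fit to the lengths of the diagonals of `lam`. -/
noncomputable def movesEquiv (hN : ∀ p, N p + N (p - 1) = diagCount lam p) :
    SetValuedDominoTableau lam ≃ {S // IsMoveSystem N S} :=
  Equiv.ofBijective (fun T => ⟨T.moves, T.isMoveSystem_moves hN⟩) <| by
    refine ⟨fun T T' h => ?_, fun S => ⟨ofMoves hN S.2, Subtype.ext (moves_ofMoves hN S.2)⟩⟩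
    have h : T.moves = T'.moves := congrArg Subtype.val h
    have hd : T.paving.dominoes = T'.paving.dominoes := by rw [T.dominoes_eq, T'.dominoes_eq, h]
    refine SetValuedDominoTableau.ext (DominoPaving.ext hd) (funext fun F => ?_)
    by_cases hF : F ∈ T.paving.dominoes
    · have hF' := hF
      rw [T.dominoes_eq] at hF'
      obtain ⟨x, hx, rfl⟩ := Finset.mem_image.1 hF'
      rw [T.entry_dominoOf hx, h, T'.entry_dominoOf (h ▸ hx)]
    · rw [T.empty_outside F hF, T'.empty_outside F (hd ▸ hF)]

end SetValuedDominoTableau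

/-! ### The 2-quotient in terms of beads -/

/-- The beads of a Young diagram: the positions `λ_i - i`, including those of empty rows. -/
def IsBead (μ : YoungDiagram) (p : ℤ) : Prop := ∃ i : ℕ, p = μ.rowLen i - i

/-- The beads are the steps at which the profile goes down. -/
theorem isBead_iff_diagRow {μ : YoungDiagram} {p : ℤ} :
    IsBead μ p ↔ diagRow μ (p - 1) = diagRow μ p + 1 := by
  have hb (p : ℤ) : (-p).toNat ≤ diagRow μ p := Nat.le_add_right _ _
  have h0 := hb p
  have h1 := hb (p - 1)
  have hprof := isProfile_diagRow μ p
  have hmem (i j : ℕ) : i < diagRow μ (boxContent (i, j)) ↔ j < μ.rowLen i := by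
    rw [← mem_iff_lt_diagRow, YoungDiagram.mem_iff_lt_rowLen]
  constructor
  · rintro ⟨i, rfl⟩
    have h2 := hmem i (μ.rowLen i)
    have h3 := hmem i (μ.rowLen i - 1)
    have e2 : boxContent (i, μ.rowLen i) = μ.rowLen i - i := rfl
    rw [e2] at h2
    rcases Nat.eq_zero_or_pos (μ.rowLen i) with h | h
    · omega
    · have e3 : boxContent (i, μ.rowLen i - 1) = μ.rowLen i - i - 1 := by
        simp only [boxContent]; omega
      rw [e3] at h3
      omega
  · intro h
    refine ⟨diagRow μ p, ?_⟩
    have h2 := hmem (diagRow μ p) (diagRow μ p + p).toNat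
    rw [show boxContent (diagRow μ p, (diagRow μ p + p).toNat) = p by
      simp only [boxContent]; omega] at h2
    rcases eq_or_ne (diagRow μ p + p) 0 with h' | h'
    · rw [h', Int.toNat_zero] at h2
      omega
    · have h3 := hmem (diagRow μ p) (diagRow μ p + p - 1).toNat
      rw [show boxContent (diagRow μ p, (diagRow μ p + p - 1).toNat) = p - 1 by
        simp only [boxContent]; omega] at h3
      omega

open Classical in
theorem diagCount_sub_one (μ : YoungDiagram) (p : ℤ) :
    diagCount μ (p - 1) + initialBead p = diagCount μ p + if IsBead μ p then 1 else 0 := by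
  have h := isProfile_diagRow μ p
  have h' := @isBead_iff_diagRow μ p
  simp only [diagRow, toNat_neg_sub_one] at h h'
  split_ifs with hb
  · have := h'.1 hb
    omega
  · have := mt h'.2 hb
    omega

theorem spreadCount_zero_add_one_even (μ ν : YoungDiagram) (q : ℤ) :
    (spreadCount 0 μ + spreadCount 1 ν) (2 * q) = diagCount μ q := by
  have h := spreadCount_two_mul 0 μ q
  rw [sub_zero] at h
  rw [Pi.add_apply, h, spreadCount, if_neg (by simp), add_zero]

theorem spreadCount_zero_add_one_odd (μ ν : YoungDiagram) (q : ℤ) :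
    (spreadCount 0 μ + spreadCount 1 ν) (2 * q - 1) = diagCount ν q := by
  rw [Pi.add_apply, spreadCount_two_mul, spreadCount, if_neg (by simp), zero_add]

/-- If the beads of `lam` at even and at odd positions are those of `μ` and `ν`, then each diagonal
of `lam` is as long as the two corresponding neighbouring diagonals of `μ` and `ν` together. -/
theorem spreadCount_add_eq_diagCount {lam μ ν : YoungDiagram}
    (hμ : ∀ q, IsBead lam (2 * q) ↔ IsBead μ q) (hν : ∀ q, IsBead lam (2 * q - 1) ↔ IsBead ν q)
    (p : ℤ) :
    (spreadCount 0 μ + spreadCount 1 ν) p + (spreadCount 0 μ + spreadCount 1 ν) (p - 1) =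
      diagCount lam p := by
  classical
  set N := spreadCount 0 μ + spreadCount 1 ν with hN
  have hstep (p : ℤ) : diagCount lam (p - 1) + N p = diagCount lam p + N (p - 2) := by
    have h := diagCount_sub_one lam p
    have : N (p - 2) + initialBead p = N p + if IsBead lam p then 1 else 0 := by
      obtain ⟨q, rfl | rfl⟩ : ∃ q, p = 2 * q ∨ p = 2 * q - 1 := ⟨(p + 1) / 2, by omega⟩
      · rw [show 2 * q - 2 = 2 * (q - 1) by ring, hN, spreadCount_zero_add_one_even,
          spreadCount_zero_add_one_even, hμ]
        simpa using (congrArg (diagCount μ (q - 1) + ·)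
          (initialBead_two_mul (ε := 0) le_rfl zero_le_one q)).trans (diagCount_sub_one μ q)
      · rw [show 2 * q - 1 - 2 = 2 * (q - 1) - 1 by ring, hN, spreadCount_zero_add_one_odd,
          spreadCount_zero_add_one_odd, hν, initialBead_two_mul zero_le_one le_rfl]
        exact diagCount_sub_one ν q
    omega
  obtain ⟨b, hb⟩ : ∃ b : ℤ, ∀ p ≤ b, diagCount lam p = 0 ∧ N p = 0 := by
    refine ⟨-(lam.colLen 0 + 2 * μ.colLen 0 + 2 * ν.colLen 0), fun p hp => ⟨?_, ?_⟩⟩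
    · exact diagCount_eq_zero (by omega)
    · obtain ⟨q, rfl | rfl⟩ : ∃ q, p = 2 * q ∨ p = 2 * q - 1 := ⟨(p + 1) / 2, by omega⟩
      · rw [hN, spreadCount_zero_add_one_even]
        exact diagCount_eq_zero (by omega)
      · rw [hN, spreadCount_zero_add_one_odd]
        exact diagCount_eq_zero (by omega)
  rcases le_total p b with hp | hp
  · rw [(hb p hp).1, (hb p hp).2, (hb (p - 1) (by omega)).2]
  · induction p, hp using Int.leInduction with
    | base => rw [(hb b le_rfl).1, (hb b le_rfl).2, (hb (b - 1) (by omega)).2]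
    | succ p hp ih =>
      have h := hstep (p + 1)
      rw [show p + 1 - 2 = p - 1 by ring, add_sub_cancel_right] at h
      rw [add_sub_cancel_right]
      omega

theorem length_betaSequence (w : List ℕ) : (betaSequence w).length = w.length := by
  induction w with
  | nil => rfl
  | cons a w ih => simp [betaSequence, ih]

theorem mem_betaSequence {w : List ℕ} {b : ℕ} :
    b ∈ betaSequence w ↔ ∃ i < w.length, b = w.getD i 0 + (w.length - 1 - i) := by
  induction w with
  | nil => simp [betaSequence]
  | cons a w ih =>
    rw [betaSequence, List.mem_cons, ih]
    constructor
    · rintro (rfl | ⟨i, hi, rfl⟩)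
      · exact ⟨0, by simp, by simp⟩
      · refine ⟨i + 1, by simpa using hi, ?_⟩
        simp only [List.getD_cons_succ, List.length_cons]
        omega
    · rintro ⟨_ | i, hi, rfl⟩
      · simp
      · refine Or.inr ⟨i, by simpa using hi, ?_⟩
        simp only [List.getD_cons_succ, List.length_cons]
        omega

/-- The beads of a diagram are given by the sequence `L` of any list of its parts, which may be
padded with zeros. -/
theorem isBead_iff_betaSequence {μ : YoungDiagram} {w : List ℕ}
    (h : ∀ i, μ.rowLen i = w.getD i 0) {p : ℤ} :
    IsBead μ p ↔ (∃ b ∈ betaSequence w, p = b - (w.length - 1)) ∨ p ≤ -w.length := by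
  constructor
  · rintro ⟨i, rfl⟩
    rw [h]
    by_cases hi : i < w.length
    · exact Or.inl ⟨_, mem_betaSequence.2 ⟨i, hi, rfl⟩, by omega⟩
    · rw [List.getD_eq_default _ _ (not_lt.1 hi)]
      omega
  · rintro (⟨b, hb, rfl⟩ | hp)
    · obtain ⟨i, hi, rfl⟩ := mem_betaSequence.1 hb
      refine ⟨i, ?_⟩
      rw [h]
      omega
    · refine ⟨(-p).toNat, ?_⟩
      rw [h, List.getD_eq_default _ _ (by omega)]
      omega

theorem betaSequence_subtractHalve {r : ℕ} {u : List ℕ} (h : u.Pairwise (· > ·))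
    (hr : ∀ a ∈ u, a % 2 = r) :
    betaSequence (subtractHalve r u) = u.map fun a => (a - r) / 2 := by
  have hlen (u : List ℕ) : (subtractHalve r u).length = u.length := by
    induction u with
    | nil => rfl
    | cons a u ih => simp [subtractHalve, ih]
  -- A strictly decreasing list of numbers of parity `r` lies above `..., r + 4, r + 2, r`.
  have hge : ∀ (u : List ℕ) (a : ℕ), (a :: u).Pairwise (· > ·) → (∀ b ∈ a :: u, b % 2 = r) →
      2 * u.length + r ≤ a := by
    intro u
    induction u with
    | nil =>
      intro a _ h
      have := h a (by simp)
      simp only [List.length_nil]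
      omega
    | cons b u ih =>
      intro a h h'
      have h1 := ih b (List.pairwise_cons.1 h).2 fun c hc => h' c (List.mem_cons_of_mem _ hc)
      have h2 := (List.pairwise_cons.1 h).1 b (by simp)
      have h3 := h' a (by simp)
      have h4 := h' b (by simp)
      simp only [List.length_cons]
      omega
  induction u with
  | nil => rfl
  | cons a u ih =>
    have := hge u a h hr
    rw [subtractHalve, betaSequence, List.map_cons, ih (List.pairwise_cons.1 h).2
      fun b hb => hr b (List.mem_cons_of_mem _ hb), hlen]
    congr 1
    omega

theorem getD_filter_ne_zero {w : List ℕ} (h : w.Pairwise (· ≥ ·)) (i : ℕ) :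
    (w.filter fun a => a ≠ 0).getD i 0 = w.getD i 0 := by
  induction w generalizing i with
  | nil => rfl
  | cons a w ih =>
    rw [List.pairwise_cons] at h
    by_cases ha : a = 0
    · have hz : ∀ b ∈ a :: w, b = 0 := by
        intro b hb
        rcases List.mem_cons.1 hb with rfl | hb
        · exact ha
        · have := h.1 b hb
          omega
      rw [List.filter_eq_nil_iff.2 fun b hb => by simpa using hz b hb, List.getD_nil]
      by_cases hi : i < (a :: w).length
      · rw [List.getD_eq_getElem _ _ hi]
        exact (hz _ (List.getElem_mem hi)).symm
      · rw [List.getD_eq_default _ _ (not_lt.1 hi)]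
    · rw [List.filter_cons_of_pos (by simpa using ha)]
      cases i with
      | zero => rfl
      | succ i => simpa using ih h.2 i

theorem rowLen_ofRowLens_eq_getD {w : List ℕ} (hw : w.SortedGE) (i : ℕ) :
    (YoungDiagram.ofRowLens w hw).rowLen i = w.getD i 0 := by
  refine eq_of_forall_lt_iff fun j => ?_
  rw [← YoungDiagram.mem_iff_lt_rowLen, YoungDiagram.mem_ofRowLens]
  by_cases hi : i < w.length
  · simp [hi]
  · rw [List.getD_eq_default _ _ (not_lt.1 hi)]
    simp [hi]

theorem rowLen_eq_getD_rowLens (μ : YoungDiagram) (i : ℕ) :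
    μ.rowLen i = μ.rowLens.getD i 0 := by
  by_cases hi : i < μ.rowLens.length
  · rw [List.getD_eq_getElem _ _ hi, YoungDiagram.get_rowLens]
  · rw [List.getD_eq_default _ _ (not_lt.1 hi)]
    rw [YoungDiagram.length_rowLens, ← YoungDiagram.mem_iff_lt_colLen,
      YoungDiagram.mem_iff_lt_rowLen] at hi
    omega

/-- The beads of a component of the 2-quotient. -/
theorem isBead_quotientParts_iff {r : ℕ} {w : List ℕ} (hw : w.SortedGE) {q : ℤ} :
    IsBead (YoungDiagram.ofRowLens (quotientParts r w) (sortedGE_quotientParts r hw)) q ↔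
      (∃ a ∈ betaSequence w, a % 2 = r ∧
        q = ((a - r) / 2 : ℕ) - (((betaSequence w).filter fun a => a % 2 = r).length - 1)) ∨
      q ≤ -((betaSequence w).filter fun a => a % 2 = r).length := by
  set u := (betaSequence w).filter fun a => a % 2 = r with hu
  have hpw : u.Pairwise (· > ·) := List.Pairwise.filter _ (pairwise_betaSequence hw.pairwise)
  have hr : ∀ a ∈ u, a % 2 = r := fun a ha => by simpa using (List.mem_filter.1 ha).2
  have hβ := betaSequence_subtractHalve hpw hr
  have hlen : (subtractHalve r u).length = u.length := by
    rw [← length_betaSequence, hβ, List.length_map]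
  rw [isBead_iff_betaSequence (w := subtractHalve r u) fun i => by
    rw [rowLen_ofRowLens_eq_getD, quotientParts, ← hu,
      getD_filter_ne_zero (pairwise_subtractHalve hpw hr).1], hβ, hlen]
  simp only [List.mem_map, hu, List.mem_filter, decide_eq_true_eq]
  constructor
  · rintro (⟨_, ⟨a, ⟨h1, h2⟩, rfl⟩, h⟩ | h)
    · exact Or.inl ⟨a, h1, h2, h⟩
    · exact Or.inr h
  · rintro (⟨a, h1, h2, h⟩ | h)
    · exact Or.inl ⟨_, ⟨a, ⟨h1, h2⟩, rfl⟩, h⟩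
    · exact Or.inr h

theorem two_mul_sum_range_neg_one_pow (n : ℕ) :
    2 * ∑ j ∈ Finset.range n, (-1 : ℤ) ^ j = 1 - (-1) ^ n := by
  induction n with
  | zero => simp
  | succ n ih => rw [Finset.sum_range_succ, mul_add, ih, pow_succ]; ring

/-- In a pavable diagram, there are as many boxes of even content as of odd content. -/
theorem Pavable.sum_neg_one_pow {lam : YoungDiagram} (h : Pavable lam) :
    ∑ c ∈ lam.cells, (-1 : ℤ) ^ (c.1 + c.2) = 0 := by
  obtain ⟨P⟩ := h
  rw [← P.cover, Finset.sum_biUnion fun F hF F' hF' hne => P.disjoint F hF F' hF' hne]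
  refine Finset.sum_eq_zero fun F _ => ?_
  obtain ⟨r, s, _ | _⟩ := F
  · rw [Domino.boxes, Finset.sum_pair (by simp [Domino.secondBox])]
    simp only [Domino.secondBox, Bool.false_eq_true, if_false]
    ring
  · rw [Domino.boxes, Finset.sum_pair (by simp [Domino.secondBox])]
    simp only [Domino.secondBox, if_true]
    ring

theorem Pavable.sum_range_neg_one_pow {lam : YoungDiagram} (h : Pavable lam) :
    ∑ i ∈ Finset.range (lam.colLen 0), (-1 : ℤ) ^ (i + lam.rowLen i) =
      ∑ i ∈ Finset.range (lam.colLen 0), (-1 : ℤ) ^ i := by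
  have h0 := h.sum_neg_one_pow
  rw [← Finset.sum_fiberwise_of_maps_to (g := Prod.fst) (t := Finset.range (lam.colLen 0))] at h0
  · have h1 (i : ℕ) : 2 * ∑ c ∈ lam.cells.filter (fun c => c.1 = i), (-1 : ℤ) ^ (c.1 + c.2) =
        (-1) ^ i - (-1) ^ (i + lam.rowLen i) := by
      have := lam.row_eq_prod (i := i)
      rw [YoungDiagram.row] at this
      rw [this, Finset.sum_product, Finset.sum_singleton]
      simp only [pow_add, ← Finset.mul_sum]
      rw [mul_left_comm, two_mul_sum_range_neg_one_pow]
      ring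
    have h2 := congrArg (2 * ·) h0
    simp only [Finset.mul_sum (Finset.range _), h1, Finset.sum_sub_distrib, mul_zero] at h2
    linarith
  · rintro ⟨i, j⟩ hc
    exact Finset.mem_range.2 (YoungDiagram.mem_iff_lt_colLen.1
      (lam.up_left_mem le_rfl (Nat.zero_le j) ((YoungDiagram.mem_cells _).1 hc)))

theorem sum_map_neg_one_pow_betaSequence (w : List ℕ) :
    ((betaSequence w).map fun a => (-1 : ℤ) ^ a).sum =
      (-1) ^ (w.length + 1) * ∑ i ∈ Finset.range w.length, (-1) ^ (i + w.getD i 0) := by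
  induction w with
  | nil => simp [betaSequence]
  | cons a w ih =>
    rw [betaSequence, List.map_cons, List.sum_cons, ih, List.length_cons, Finset.sum_range_succ']
    simp only [List.getD_cons_succ, List.getD_cons_zero, add_right_comm _ 1, pow_succ _ (_ + _),
      ← Finset.sum_mul]
    ring

theorem sum_map_neg_one_pow (L : List ℕ) :
    (L.map fun a => (-1 : ℤ) ^ a).sum =
      (L.filter fun a => a % 2 = 0).length - (L.filter fun a => a % 2 = 1).length := by
  induction L with
  | nil => simp
  | cons a L ih =>
    rw [List.map_cons, List.sum_cons, ih, List.filter_cons, List.filter_cons]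
    rcases Nat.mod_two_eq_zero_or_one a with h | h
    · rw [(Nat.even_iff.2 h).neg_one_pow]
      simp [h]
      ring
    · rw [(Nat.odd_iff.2 h).neg_one_pow]
      simp [h]
      ring

/-- The 2-core of a pavable diagram is empty: the sequence `L` of a diagram with `k` rows has
`⌈k / 2⌉` even and `⌊k / 2⌋` odd components. -/
theorem Pavable.length_filter_betaSequence {lam : YoungDiagram} (h : Pavable lam) :
    ((betaSequence lam.rowLens).filter fun a => a % 2 = 0).length = (lam.rowLens.length + 1) / 2 ∧
      ((betaSequence lam.rowLens).filter fun a => a % 2 = 1).length = lam.rowLens.length / 2 := by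
  have h1 := sum_map_neg_one_pow_betaSequence lam.rowLens
  rw [sum_map_neg_one_pow] at h1
  simp only [← rowLen_eq_getD_rowLens] at h1
  rw [YoungDiagram.length_rowLens] at *
  rw [h.sum_range_neg_one_pow] at h1
  have h2 := two_mul_sum_range_neg_one_pow (lam.colLen 0)
  have h3 : ((betaSequence lam.rowLens).filter fun a => a % 2 = 0).length +
      ((betaSequence lam.rowLens).filter fun a => a % 2 = 1).length = lam.colLen 0 := by
    have := List.length_eq_length_filter_add (l := betaSequence lam.rowLens)
      (fun a => decide (a % 2 = 0))
    rw [length_betaSequence, YoungDiagram.length_rowLens] at this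
    rw [this]
    congr 3
    funext a
    rcases Nat.mod_two_eq_zero_or_one a with h | h <;> simp [h]
  rcases Nat.even_or_odd (lam.colLen 0) with hk | hk
  · rw [hk.neg_one_pow] at h2
    rw [hk.add_one.neg_one_pow] at h1
    obtain ⟨m, hm⟩ := hk
    omega
  · rw [hk.neg_one_pow] at h2
    rw [hk.add_one.neg_one_pow] at h1
    obtain ⟨m, hm⟩ := hk
    omega

/-- The two components of the 2-quotient, in one order or the other depending on the parity of the
number of rows, describe the lengths of the diagonals of a pavable diagram. -/
theorem Pavable.exists_spreadCount {lam μ ν : YoungDiagram} (h : Pavable lam)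
    (hq : twoQuotient lam = (μ, ν)) :
    (∀ p, (spreadCount 0 μ + spreadCount 1 ν) p + (spreadCount 0 μ + spreadCount 1 ν) (p - 1) =
      diagCount lam p) ∨
    (∀ p, (spreadCount 0 ν + spreadCount 1 μ) p + (spreadCount 0 ν + spreadCount 1 μ) (p - 1) =
      diagCount lam p) := by
  obtain ⟨rfl, rfl⟩ := Prod.mk.inj hq
  obtain ⟨h0, h1⟩ := h.length_filter_betaSequence
  have hlam (p : ℤ) := isBead_iff_betaSequence (p := p) (rowLen_eq_getD_rowLens lam)
  have hμ (q : ℤ) := isBead_quotientParts_iff (r := 0) (q := q) lam.rowLens_sorted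
  have hν (q : ℤ) := isBead_quotientParts_iff (r := 1) (q := q) lam.rowLens_sorted
  rw [h0] at hμ
  rw [h1] at hν
  rcases Nat.even_or_odd lam.rowLens.length with hk | hk
  · right
    obtain ⟨m, hm⟩ := hk
    refine spreadCount_add_eq_diagCount (fun q => ?_) fun q => ?_
    · rw [hlam, hν]
      refine or_congr (exists_congr fun a => and_congr_right fun _ => ?_) ?_ <;> omega
    · rw [hlam, hμ]
      refine or_congr (exists_congr fun a => and_congr_right fun _ => ?_) ?_ <;> omega
  · left
    obtain ⟨m, hm⟩ := hk
    refine spreadCount_add_eq_diagCount (fun q => ?_) fun q => ?_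
    · rw [hlam, hμ]
      refine or_congr (exists_congr fun a => and_congr_right fun _ => ?_) ?_ <;> omega
    · rw [hlam, hν]
      refine or_congr (exists_congr fun a => and_congr_right fun _ => ?_) ?_ <;> omega

/-! ### The generating functions -/

/-- The monomial of a system of moves: the exponent of `x_i` is the number of sets containing
`i`. -/
noncomputable def movesWeight (S : Finset Move) : ℕ+ →₀ ℕ := ∑ x ∈ S, ∑ i ∈ x.2, Finsupp.single i 1

/-- The signed monomial of a system of moves. -/
noncomputable def movesTerm (S : Finset Move) : MvPowerSeries ℕ+ ℤ :=
  MvPowerSeries.monomial (movesWeight S) ((-1 : ℤ) ^ (∑ x ∈ S, x.2.card - S.card))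

theorem movesTerm_union {S S' : Finset Move} (h : ∀ x ∈ S, x.2.Nonempty)
    (h' : ∀ x ∈ S', x.2.Nonempty) (hd : Disjoint S S') :
    movesTerm (S ∪ S') = movesTerm S * movesTerm S' := by
  have hle {S : Finset Move} (h : ∀ x ∈ S, x.2.Nonempty) : S.card ≤ ∑ x ∈ S, x.2.card := by
    simpa using Finset.card_nsmul_le_sum S (fun x => x.2.card) 1 fun x hx => (h x hx).card_pos
  rw [movesTerm, movesTerm, movesTerm, MvPowerSeries.monomial_mul_monomial, movesWeight,
    movesWeight, movesWeight, Finset.sum_union hd, Finset.sum_union hd,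
    Finset.card_union_of_disjoint hd, ← pow_add]
  have h1 := hle h
  have h2 := hle h'
  congr 2
  omega

theorem SetValuedTableau.movesTerm_moves {μ : YoungDiagram} (ε : ℤ) (T : SetValuedTableau μ) :
    movesTerm (T.moves ε) = MvPowerSeries.monomial T.weight ((-1 : ℤ) ^ (T.size - μ.card)) := by
  rw [movesTerm, movesWeight, SetValuedTableau.moves, Finset.sum_image (T.injOn_boxMove ε),
    Finset.sum_image (T.injOn_boxMove ε), Finset.card_image_of_injOn (T.injOn_boxMove ε)]
  rfl

theorem SetValuedDominoTableau.movesTerm_moves {lam : YoungDiagram}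
    (T : SetValuedDominoTableau lam) :
    movesTerm T.moves =
      MvPowerSeries.monomial T.weight ((-1 : ℤ) ^ (T.size - lam.card / 2)) := by
  rw [movesTerm, movesWeight, SetValuedDominoTableau.moves, Finset.sum_image T.injOn_dominoMove,
    Finset.sum_image T.injOn_dominoMove, Finset.card_image_of_injOn T.injOn_dominoMove,
    T.paving.card_eq, Nat.mul_div_cancel_left _ two_pos]
  rfl

/-- Set-valued domino tableaux correspond to pairs of set-valued tableaux. -/
noncomputable def dominoTableauEquiv {lam μ ν : YoungDiagram}
    (hN : ∀ p, (spreadCount 0 μ + spreadCount 1 ν) p + (spreadCount 0 μ + spreadCount 1 ν) (p - 1) =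
      diagCount lam p) :
    SetValuedTableau μ × SetValuedTableau ν ≃ SetValuedDominoTableau lam :=
  ((SetValuedTableau.movesEquiv le_rfl zero_le_one μ).prodCongr
    (SetValuedTableau.movesEquiv zero_le_one le_rfl ν)).trans
  ((IsMoveSystem.splitEquiv
    (fun _ hp => if_neg (by rwa [add_zero]))
    (fun _ hp => if_neg (by rwa [Int.even_add_one, not_not]))).trans
  (SetValuedDominoTableau.movesEquiv hN).symm)

theorem moves_dominoTableauEquiv {lam μ ν : YoungDiagram}
    (hN : ∀ p, (spreadCount 0 μ + spreadCount 1 ν) p + (spreadCount 0 μ + spreadCount 1 ν) (p - 1) =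
      diagCount lam p) (T : SetValuedTableau μ × SetValuedTableau ν) :
    (dominoTableauEquiv hN T).moves = T.1.moves 0 ∪ T.2.moves 1 :=
  congrArg Subtype.val ((SetValuedDominoTableau.movesEquiv hN).apply_symm_apply
    (IsMoveSystem.splitEquiv _ _ (SetValuedTableau.movesEquiv le_rfl zero_le_one μ T.1,
      SetValuedTableau.movesEquiv zero_le_one le_rfl ν T.2)))

theorem summable_stableGrothendieck_mul (μ ν : YoungDiagram) :
    Summable fun T : SetValuedTableau μ × SetValuedTableau ν =>
      MvPowerSeries.monomial T.1.weight ((-1 : ℤ) ^ (T.1.size - μ.card)) *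
        MvPowerSeries.monomial T.2.weight ((-1 : ℤ) ^ (T.2.size - ν.card)) := by
  rw [MvPowerSeries.WithPiTopology.summable_iff_summable_coeff]
  intro α
  have hfin (μ : YoungDiagram) : {T : SetValuedTableau μ | T.weight ≤ α}.Finite :=
    ((Set.finite_Iic α).biUnion fun β _ => SetValuedTableau.finite_weight_eq β).subset
      fun T hT => Set.mem_biUnion (Set.mem_Iic.2 hT) rfl
  refine summable_of_hasFiniteSupport (((hfin μ).prod (hfin ν)).subset ?_)
  intro T hT
  have h : T.1.weight + T.2.weight = α := by
    by_contra h
    refine hT ?_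
    simp only [MvPowerSeries.monomial_mul_monomial]
    exact MvPowerSeries.coeff_monomial_ne (fun h' => h h'.symm) _
  exact ⟨le_self_add.trans_eq h, le_add_self.trans_eq h⟩

theorem hasSum_of_spreadCount {lam μ ν : YoungDiagram}
    (hN : ∀ p, (spreadCount 0 μ + spreadCount 1 ν) p + (spreadCount 0 μ + spreadCount 1 ν) (p - 1) =
      diagCount lam p) :
    HasSum
      (fun T : SetValuedDominoTableau lam =>
        MvPowerSeries.monomial T.weight ((-1 : ℤ) ^ (T.size - lam.card / 2)))
      (stableGrothendieck μ * stableGrothendieck ν) := by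
  rw [← (dominoTableauEquiv hN).hasSum_iff]
  refine ((summable_stableGrothendieck μ).hasSum.mul (summable_stableGrothendieck ν).hasSum
    (summable_stableGrothendieck_mul μ ν)).congr_fun ?_
  intro T
  rw [Function.comp_apply, ← SetValuedDominoTableau.movesTerm_moves, moves_dominoTableauEquiv,
    movesTerm_union, SetValuedTableau.movesTerm_moves, SetValuedTableau.movesTerm_moves]
  · exact (T.1.isMoveSystem_moves le_rfl zero_le_one).nonempty
  · exact (T.2.isMoveSystem_moves zero_le_one le_rfl).nonempty
  · rw [Finset.disjoint_left]
    intro x hx hx'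
    obtain ⟨c, -, rfl⟩ := Finset.mem_image.1 hx
    obtain ⟨c', -, h⟩ := Finset.mem_image.1 hx'
    have := congrArg Prod.fst h
    simp only [SetValuedTableau.boxMove] at this
    omega

theorem mainTheorem2 (lam μ ν : YoungDiagram) (hpav : Pavable lam)
    (hquot : twoQuotient lam = (μ, ν)) :
    HasSum
      (fun T : SetValuedDominoTableau lam =>
        MvPowerSeries.monomial T.weight ((-1 : ℤ) ^ (T.size - lam.card / 2)))
      (stableGrothendieck μ * stableGrothendieck ν) := by
  rcases hpav.exists_spreadCount hquot with hN | hN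
  · exact hasSum_of_spreadCount hN
  · rw [mul_comm]
    exact hasSum_of_spreadCount hN
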